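/- **Conventions.** For $\chi\ge 0$ let $p_\chi(n)=n^\chi$ (the polynomial scale). Suprema over empty sets of $\chi\ge0$ are $0$. *Topological slow entropy.* Let $f:X\to X$ be a map of a metric space $(X,d)$. For compact $K\subseteq X$, $\varepsilon>0$ and $n\ge1$, let $N_{f,K}(\varepsilon,n)$ be the minimal number of Bowen balls $\{y : d(f^ix,f^iy)<\varepsilon,\ 0\le i<n\}$, $x\in X$, needed to cover $K$. Put $$h_{\mathrm{top},p_\chi}(f)=\sup_K\lim_{\varepsilon\to0^+}\sup\Big\{\chi\ge0:\limsup_{n\to\infty}\frac{N_{f,K}(\varepsilon,n)}{n^\chi}>0\Big\}.$$ *Metric slow entropy.* Let $f$ preserve a Borel probability measure $\mu$. For a finite measurable partition $\mathcal P$ let $\bar d^{\,n}_{f,\mathcal P}(x,y)$ be the proportion of times $0\le s<n$ at which $f^sx$ and $f^sy$ lie in different atoms of $\mathcal P$, and let $S_{f,\mathcal P}(\varepsilon,n)$ be the minimal cardinality of a finite set $F\subseteq X$ with $\mu\big(\bigcup_{x\in F}\{y:\bar d^{\,n}_{f,\mathcal P}(x,y)<\varepsilon\}\big)>1-\varepsilon$.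 Put $$h_{\mu,p_\chi}(f)=\sup_{\mathcal P}\lim_{\varepsilon\to0^+}\sup\Big\{\chi\ge0:\limsup_{n\to\infty}\frac{S_{f,\mathcal P}(\varepsilon,n)}{n^\chi}>0\Big\}.$$ *Sturmian shifts.* A sequence $u\in\{0,1\}^{\mathbb Z}$ is Sturmian if exactly $n+1$ words of each length $n\ge1$ appear in it and it is not eventually periodic (in either direction). For $\beta\in(0,1)$ let $u^\beta_n=0$ if the fractional part of $n\beta$ is less than $1-\beta$, and $u^\beta_n=1$ otherwise, let $X_\beta\subseteq\{0,1\}^{\mathbb Z}$ be the closure of the two-sided shift orbit of $u^\beta$, and let $\sigma_\beta:X_\beta\to X_\beta$ be the shift $(\sigma_\beta\omega)_n=\omega_{n+1}$. The metric on $\{0,1\}^{\mathbb Z}$ is $d(\omega,\eta)=2^{-k}$ with $k=\min\{i\ge0:\omega_i\ne\eta_i\text{ or }\omega_{-i}\neq\eta_{-i}\}$ for $\omega\ne\eta$, and products carry the maximum metric. **Theorem.** For every $m\in\mathbb N$ there exist $\beta_1,\dots,\beta_m\in(0,1)$ such that $1,\beta_1,\dots,\beta_m$ are linearly independent over $\mathbb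 Q$, each $u^{\beta_i}$ is Sturmian, and the product homeomorphism $f=\sigma_{\beta_1}\times\dots\times\sigma_{\beta_m}$ of the compact metric space $X=X_{\beta_1}\times\dots\times X_{\beta_m}$ is uniquely ergodic (it has exactly one invariant Borel probability measure $\mu$) and satisfies $$h_{\mu,p_\chi}(f)=0\qquad\text{and}\qquad h_{\mathrm{top},p_\chi}(f)=m.$$ -/

import Mathlib

open Set Filter Topology MeasureTheory
open scoped NNReal ENNReal

noncomputable section

namespace SlowEntropy

/-! ### Scales -/

/-- The polynomial scale `p_χ(n) = n ^ χ`, `χ ≥ 0`. -/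
def polyScale (χ : ℝ≥0) (n : ℕ) : ℝ≥0 := (n : ℝ≥0) ^ (χ : ℝ)

/-- For a counting function `N`, the supremum of the `χ ≥ 0` with
`limsup_n N n / a χ n > 0` (equal to `0` if there is no such `χ`). -/
def growthExponent (a : ℝ≥0 → ℕ → ℝ≥0) (N : ℕ → ℕ∞) : ℝ≥0∞ :=
  ⨆ (χ : ℝ≥0) (_ : 0 < limsup (fun n => (N n : ℝ≥0∞) / (a χ n : ℝ≥0∞)) atTop), (χ : ℝ≥0∞)

theorem growthExponent_mono (a : ℝ≥0 → ℕ → ℝ≥0) {N N' : ℕ → ℕ∞} (h : ∀ n, N n ≤ N' n) :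
    growthExponent a N ≤ growthExponent a N' := by
  refine iSup_mono fun χ => iSup_mono' fun hχ => ⟨hχ.trans_le ?_, le_rfl⟩
  exact limsup_le_limsup (Eventually.of_forall fun n =>
    ENNReal.div_le_div_right (ENat.toENNReal_le.2 (h n)) _)

/-! ### Topological slow entropy -/

section Top

variable {X : Type*} [PseudoMetricSpace X]

/-- `N_{f,K}(ε, n)`: the minimal number of `(ε, n)`-Bowen balls
`{y | ∀ i < n, d (f^i x) (f^i y) < ε}` which cover `K`. -/
def coverNumber (f : X → X) (K : Set X) (ε : ℝ) (n : ℕ) : ℕ∞ :=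
  Dynamics.coverMincard f K {p : X × X | dist p.1 p.2 < ε} n

/-- The topological slow entropy at the scale `a`. The inner quantity is antitone in `ε`, so that
the `limsup` as `ε → 0⁺` is a limit, see `tendsto_growthExponent_coverNumber`. -/
def topSlowEntropy (a : ℝ≥0 → ℕ → ℝ≥0) (f : X → X) : ℝ≥0∞ :=
  ⨆ (K : Set X) (_ : IsCompact K),
    limsup (fun ε : ℝ => growthExponent a (coverNumber f K ε)) (𝓝[>] 0)

theorem tendsto_growthExponent_coverNumber (a : ℝ≥0 → ℕ → ℝ≥0) (f : X → X) (K : Set X) :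
    Tendsto (fun ε : ℝ => growthExponent a (coverNumber f K ε)) (𝓝[>] 0)
      (𝓝 (limsup (fun ε : ℝ => growthExponent a (coverNumber f K ε)) (𝓝[>] 0))) := by
  have h : Antitone fun ε : ℝ => growthExponent a (coverNumber f K ε) := fun ε ε' hε =>
    growthExponent_mono a fun n => Dynamics.coverMincard_antitone f K n
      fun p (hp : dist p.1 p.2 < ε) => hp.trans_le hε
  have := h.tendsto_nhdsGT 0
  rwa [this.limsup_eq]

end Top

/-! ### Metric slow entropy -/

section Metric

variable {X : Type*}

/-- The Hamming distance of the `P`-names of length `n` of `x` and `y`. A finite partition is given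
by its labelling map `P : X → Fin k`. -/
def hammingDistance {k : ℕ} (f : X → X) (P : X → Fin k) (n : ℕ) (x y : X) : ℝ :=
  1 - (((Finset.range n).filter fun s => P (f^[s] x) = P (f^[s] y)).card : ℝ) / n

/-- The `(ε, n)`-Hamming ball centred at `x`. -/
def hammingBall {k : ℕ} (f : X → X) (P : X → Fin k) (n : ℕ) (x : X) (ε : ℝ) : Set X :=
  {y | hammingDistance f P n x y < ε}

variable [MeasurableSpace X]

/-- `S_{f,P}(ε, n)`: the minimal number of `(ε, n)`-Hamming balls whose union has measure greater
than `1 - ε`. -/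
def hammingCoverNumber {k : ℕ} (μ : Measure X) (f : X → X) (P : X → Fin k) (ε : ℝ) (n : ℕ) : ℕ∞ :=
  ⨅ (F : Finset X) (_ : 1 - ε < μ.real (⋃ x ∈ F, hammingBall f P n x ε)), (F.card : ℕ∞)

/-- The metric slow entropy at the scale `a`; the supremum is over all finite measurable
partitions. The inner quantity is antitone in `ε`, so that the `limsup` as `ε → 0⁺` is a limit, see
`tendsto_growthExponent_hammingCoverNumber`. -/
def metricSlowEntropy (a : ℝ≥0 → ℕ → ℝ≥0) (μ : Measure X) (f : X → X) : ℝ≥0∞ :=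
  ⨆ (k : ℕ) (P : X → Fin k) (_ : Measurable P),
    limsup (fun ε : ℝ => growthExponent a (hammingCoverNumber μ f P ε)) (𝓝[>] 0)

theorem tendsto_growthExponent_hammingCoverNumber (a : ℝ≥0 → ℕ → ℝ≥0) (μ : Measure X)
    [IsFiniteMeasure μ] (f : X → X) {k : ℕ} (P : X → Fin k) :
    Tendsto (fun ε : ℝ => growthExponent a (hammingCoverNumber μ f P ε)) (𝓝[>] 0)
      (𝓝 (limsup (fun ε : ℝ => growthExponent a (hammingCoverNumber μ f P ε)) (𝓝[>] 0))) := by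
  have h : Antitone fun ε : ℝ => growthExponent a (hammingCoverNumber μ f P ε) := by
    intro ε ε' hε
    refine growthExponent_mono a fun n => iInf_mono fun F => iInf_mono' fun hF => ⟨?_, le_rfl⟩
    refine (sub_le_sub_left hε 1).trans_lt (hF.trans_le (measureReal_mono ?_ (measure_ne_top μ _)))
    exact iUnion₂_mono fun x _ y (hy : _ < ε) => hy.trans_le hε
  have := h.tendsto_nhdsGT 0
  rwa [this.limsup_eq]

/-- `f` is uniquely ergodic and `μ` is its unique invariant probability measure. -/
structure IsUniquelyErgodic (f : X → X) (μ : Measure X) : Prop where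
  isProbabilityMeasure : IsProbabilityMeasure μ
  measurePreserving : MeasurePreserving f μ μ
  unique : ∀ ν : Measure X, IsProbabilityMeasure ν → MeasurePreserving f ν ν → ν = μ

end Metric

/-! ### The full shift on two symbols -/

/-- The space `{0,1}^ℤ`. -/
def FullShift : Type := ℤ → Fin 2

namespace FullShift

instance : TopologicalSpace FullShift := inferInstanceAs (TopologicalSpace (ℤ → Fin 2))
instance : CompactSpace FullShift := inferInstanceAs (CompactSpace (ℤ → Fin 2))
instance : SecondCountableTopology FullShift :=
  inferInstanceAs (SecondCountableTopology (ℤ → Fin 2))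

open Classical in
/-- `d(ω, η) = 2^{-k}`, where `k` is the least `i ≥ 0` with `ω_i ≠ η_i` or `ω_{-i} ≠ η_{-i}`. -/
instance : Dist FullShift where
  dist x y := if x = y then 0 else (1 / 2) ^ sInf {i : ℕ | x i ≠ y i ∨ x (-i) ≠ y (-i)}

theorem exists_ne {x y : FullShift} (h : x ≠ y) :
    {i : ℕ | x i ≠ y i ∨ x (-i) ≠ y (-i)}.Nonempty := by
  obtain ⟨j, hj⟩ := Function.ne_iff.1 h
  obtain ⟨i, rfl | rfl⟩ := j.eq_nat_or_neg
  · exact ⟨i, Or.inl hj⟩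
  · exact ⟨i, Or.inr hj⟩

theorem dist_lt_iff {x y : FullShift} (k : ℕ) :
    dist x y < (1 / 2) ^ k ↔ ∀ i : ℕ, i ≤ k → x i = y i ∧ x (-i) = y (-i) := by
  by_cases h : x = y
  · subst h
    simp [dist]
  · have e : dist x y = (1 / 2) ^ sInf {i : ℕ | x i ≠ y i ∨ x (-i) ≠ y (-i)} := if_neg h
    rw [e, pow_lt_pow_iff_right_of_lt_one₀ (by norm_num) (by norm_num)]
    constructor
    · intro hk i hi
      have := notMem_of_lt_csInf' (lt_of_le_of_lt hi hk)
      simp only [mem_ofPred_eq] at this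
      tauto
    · intro H
      by_contra hc
      have := Nat.sInf_mem (exists_ne h)
      have h2 := H _ (not_lt.1 hc)
      simp only [mem_ofPred_eq] at this
      tauto

theorem dist_lt_of_dist_lt {x y z : FullShift} (k : ℕ) (h₁ : dist x y < (1 / 2) ^ k)
    (h₂ : dist y z < (1 / 2) ^ k) : dist x z < (1 / 2) ^ k := by
  rw [dist_lt_iff] at *
  exact fun i hi => ⟨(h₁ i hi).1.trans (h₂ i hi).1, (h₁ i hi).2.trans (h₂ i hi).2⟩

theorem dist_nonneg' (x y : FullShift) : 0 ≤ dist x y := by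
  simp only [dist]
  split_ifs <;> positivity

theorem dist_comm' (x y : FullShift) : dist x y = dist y x := by
  have h : {i : ℕ | x i ≠ y i ∨ x (-i) ≠ y (-i)} = {i : ℕ | y i ≠ x i ∨ y (-i) ≠ x (-i)} := by
    ext i
    simp only [mem_ofPred_eq, ne_comm (a := x _)]
  by_cases hxy : x = y
  · rw [hxy]
  · have hyx : y ≠ x := fun e => hxy e.symm
    simp only [dist, h, if_neg hxy, if_neg hyx]

theorem dist_triangle' (x y z : FullShift) : dist x z ≤ dist x y + dist y z := by
  by_contra! hlt
  have hxy := dist_nonneg' x y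
  have hyz := dist_nonneg' y z
  have hne : x ≠ z := by
    rintro rfl
    have : dist x x = 0 := if_pos rfl
    linarith
  have e : dist x z = (1 / 2) ^ sInf {i : ℕ | x i ≠ z i ∨ x (-i) ≠ z (-i)} := if_neg hne
  rw [e] at hlt
  exact absurd (dist_lt_of_dist_lt (y := y) _ (lt_of_le_of_lt (by linarith) hlt)
    (lt_of_le_of_lt (by linarith) hlt)) (not_lt.2 e.ge)

theorem isOpen_iff' (s : Set FullShift) :
    IsOpen s ↔ ∀ x ∈ s, ∃ ε > 0, ∀ y, dist x y < ε → y ∈ s := by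
  constructor
  · intro hs x hx
    obtain ⟨I, v, hv, hI⟩ := isOpen_pi_iff (A := fun _ : ℤ => Fin 2) |>.1 hs x hx
    refine ⟨(1 / 2) ^ I.sup Int.natAbs, by positivity, fun y hy => hI fun i hi => ?_⟩
    rw [dist_lt_iff] at hy
    obtain ⟨h₁, h₂⟩ := hy i.natAbs (Finset.le_sup (f := Int.natAbs) hi)
    have : x i = y i := by
      rcases Int.natAbs_eq i with h | h
      · rw [h]; exact h₁
      · rw [h]; exact h₂
    rw [← this]
    exact (hv i hi).2
  · intro H
    rw [isOpen_iff_mem_nhds]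
    intro x hx
    obtain ⟨ε, hε, h⟩ := H x hx
    obtain ⟨k, hk⟩ := exists_pow_lt_of_lt_one hε (show (1 / 2 : ℝ) < 1 by norm_num)
    have hev : ∀ j : ℤ, ∀ᶠ y : FullShift in 𝓝 x, x j = y j := fun j =>
      ((continuous_apply (A := fun _ : ℤ => Fin 2) j).continuousAt.eventually_mem
        (mem_nhds_discrete.2 (mem_singleton _))).mono fun y hy => Eq.symm hy
    have : ∀ᶠ y : FullShift in 𝓝 x, ∀ i ∈ Finset.range (k + 1), x i = y i ∧ x (-i) = y (-i) :=
      (Finset.eventually_all _).2 fun i _ => (hev i).and (hev (-i))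
    filter_upwards [this] with y hy
    exact h y (((dist_lt_iff k).2 fun i hi =>
      hy i (Finset.mem_range.2 (Nat.lt_succ_of_le hi))).trans hk)

/-- The metric induces the product topology. -/
instance : MetricSpace FullShift :=
  MetricSpace.ofDistTopology dist
    (fun x => if_pos rfl)
    dist_comm'
    dist_triangle'
    isOpen_iff'
    (fun x y h => by
      by_contra hne
      have e : dist x y = (1 / 2) ^ sInf {i : ℕ | x i ≠ y i ∨ x (-i) ≠ y (-i)} := if_neg hne
      exact absurd (e.symm.trans h) (by positivity))

instance : MeasurableSpace FullShift := borel FullShift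
instance : BorelSpace FullShift := ⟨rfl⟩

/-- The shift map `σ(ω)_n = ω_{n+1}`. -/
def shift : FullShift ≃ₜ FullShift where
  toFun x n := x (n + 1)
  invFun x n := x (n - 1)
  left_inv x := by funext n; simp
  right_inv x := by funext n; simp
  continuous_toFun := continuous_pi fun n => continuous_apply (A := fun _ : ℤ => Fin 2) (n + 1)
  continuous_invFun := continuous_pi fun n => continuous_apply (A := fun _ : ℤ => Fin 2) (n - 1)

end FullShift

/-! ### Sturmian systems -/

/-- The words of length `n` that appear in `u`. -/
def words (u : FullShift) (n : ℕ) : Set (Fin n → Fin 2) :=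
  {w | ∃ k : ℤ, ∀ j : Fin n, w j = u (k + (j : ℕ))}

/-- `u` is a bi-infinite Sturmian sequence: exactly `n + 1` words of each length `n ≥ 1` appear in
it, and it is eventually periodic neither to the right nor to the left. -/
structure IsSturmian (u : FullShift) : Prop where
  complexity : ∀ n : ℕ, 1 ≤ n → (words u n).ncard = n + 1
  not_periodic_right : ¬ ∃ p : ℤ, 0 < p ∧ ∃ N : ℤ, ∀ n : ℤ, N ≤ n → u (n + p) = u n
  not_periodic_left : ¬ ∃ p : ℤ, 0 < p ∧ ∃ N : ℤ, ∀ n : ℤ, n ≤ N → u (n - p) = u n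

/-- The coding of the orbit of `0` under the rotation `x ↦ x + β` of `ℝ/ℤ` with respect to the
intervals `I₀ = [0, 1 - β)` and `I₁ = [1 - β, 1)`. -/
def rotationCoding (β : ℝ) : FullShift :=
  fun n => if Int.fract (n * β) < 1 - β then 0 else 1

/-- `X_u`, the closure of the (two-sided) shift orbit of `u`. -/
def orbitClosure (u : FullShift) : Set FullShift :=
  closure (range fun k : ℤ => (FullShift.shift ^ k) u)

theorem shift_mem_orbitClosure_iff (u x : FullShift) :
    x ∈ orbitClosure u ↔ FullShift.shift x ∈ orbitClosure u := by
  have h : FullShift.shift ⁻¹' (range fun k : ℤ => (FullShift.shift ^ k) u) =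
      range fun k : ℤ => (FullShift.shift ^ k) u := by
    ext y
    constructor
    · rintro ⟨k, hk⟩
      refine ⟨-1 + k, ?_⟩
      have hk' : (FullShift.shift ^ k) u = FullShift.shift y := hk
      change (FullShift.shift ^ (-1 + k)) u = y
      rw [zpow_add, Homeomorph.mul_apply, hk', zpow_neg_one]
      exact FullShift.shift.symm_apply_apply y
    · rintro ⟨k, rfl⟩
      refine ⟨1 + k, ?_⟩
      change (FullShift.shift ^ (1 + k)) u = FullShift.shift ((FullShift.shift ^ k) u)
      rw [zpow_add, Homeomorph.mul_apply, zpow_one]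
  change x ∈ orbitClosure u ↔ x ∈ FullShift.shift ⁻¹' orbitClosure u
  rw [orbitClosure, Homeomorph.preimage_closure, h]

/-- The system `(X_u, σ)`: the shift restricted to the orbit closure of `u`. -/
def subshift (u : FullShift) : orbitClosure u ≃ₜ orbitClosure u :=
  FullShift.shift.subtype (shift_mem_orbitClosure_iff u)

/-- The phase space `X₁ × ⋯ × X_m` of the product of the systems generated by `u₁, …, u_m`, with
the maximum metric. -/
abbrev ProductSpace {m : ℕ} (u : Fin m → FullShift) : Type := ∀ i, orbitClosure (u i)

/-- The product homeomorphism `σ₁ × ⋯ × σ_m`. -/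
def productShift {m : ℕ} (u : Fin m → FullShift) : ProductSpace u ≃ₜ ProductSpace u :=
  Homeomorph.piCongrRight fun i => subshift (u i)

end SlowEntropy

end

noncomputable section

namespace SlowEntropy

/-! ### Polynomial growth -/

/-! The Sturmian system of an irrational `β` is the circle rotation by `β` with one orbit split.
`phase` sends a sequence to the circle point that it codes, and `pointCoding` recovers the sequence
whenever that point is off the countable orbit of `0`. So the product is the torus rotation by `(β₁,
…, β_m)` up to null sets, but not topologically; the two entropies differ for this reason.

Topologically, a Bowen ball of length `n` amounts to a word of length about `n` in each coordinate.
A Sturmian sequence has `n + 1` words of length `n` (`ncard_words_rotationCoding`), so the cover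
numbers have exact order `n ^ m` (`coverNumber_le`, `le_coverNumber`).

Metrically, a small translation `t` of the torus changes the label of a partition only on a set of
small measure, and by invariance of Haar measure this measure is the mean Hamming distance between
`x` and `x + t` for every length `n` (`lintegral_hammingDistance_translate`). Hence, off a small
set, Hamming balls have measure bounded below uniformly in `n`, and the cover numbers are bounded
(`exists_forall_hammingCoverNumber_le`).

Rational independence makes the rotation uniquely ergodic, by Fourier coefficients
(`eq_of_measurePreserving_add_torusPoint`), and the almost everywhere inverse coding lifts this to
the product shift. Powers of a transcendental number supply independent `βᵢ`. -/

theorem growthExponent_le_of_le_mul_pow {N : ℕ → ℕ∞} (m C : ℕ)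
    (h : ∀ n : ℕ, 1 ≤ n → N n ≤ ((C * n ^ m : ℕ) : ℕ∞)) :
    growthExponent polyScale N ≤ m := by
  refine iSup₂_le fun χ hχ => ?_
  by_contra! hlt
  have hlt' : (m : ℝ) < χ := by
    have : ((m : ℝ≥0) : ℝ≥0∞) < χ := by simpa using hlt
    exact_mod_cast this
  refine hχ.ne' (Tendsto.limsup_eq ?_)
  have hreal : Tendsto (fun n : ℕ => (C : ℝ) * (n : ℝ) ^ (-(χ - m : ℝ))) atTop (𝓝 0) := by
    have := (tendsto_rpow_neg_atTop (sub_pos.2 hlt')).comp tendsto_natCast_atTop_atTop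
    simpa using this.const_mul (C : ℝ)
  have henn := ENNReal.tendsto_ofReal hreal
  rw [ENNReal.ofReal_zero] at henn
  refine tendsto_of_tendsto_of_tendsto_of_le_of_le' tendsto_const_nhds henn
    (Eventually.of_forall fun _ => zero_le) ?_
  filter_upwards [eventually_ge_atTop 1] with n hn
  have hn0 : (0 : ℝ) < n := by exact_mod_cast hn
  have hN : (N n : ℝ≥0∞) ≤ ENNReal.ofReal (C * n ^ m) := by
    refine (ENat.toENNReal_le.2 (h n hn)).trans (le_of_eq ?_)
    rw [ENat.toENNReal_coe, ← ENNReal.ofReal_natCast]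
    push_cast
    rfl
  have hp : ((polyScale χ n : ℝ≥0) : ℝ≥0∞) = ENNReal.ofReal ((n : ℝ) ^ (χ : ℝ)) := by
    rw [← ENNReal.ofReal_coe_nnreal]
    simp [polyScale]
  refine (ENNReal.div_le_div_right hN _).trans (le_of_eq ?_)
  rw [hp, ← ENNReal.ofReal_div_of_pos (by positivity)]
  congr 1
  rw [neg_sub, Real.rpow_sub hn0, Real.rpow_natCast]
  ring

theorem le_growthExponent_of_pow_le {N : ℕ → ℕ∞} (m : ℕ)
    (h : ∀ n : ℕ, 1 ≤ n → ((n ^ m : ℕ) : ℕ∞) ≤ N n) :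
    m ≤ growthExponent polyScale N := by
  have key : ∀ᶠ n : ℕ in atTop, (1 : ℝ≥0∞) ≤ (N n : ℝ≥0∞) / (polyScale m n : ℝ≥0∞) := by
    filter_upwards [eventually_ge_atTop 1] with n hn
    have hp : ((polyScale m n : ℝ≥0) : ℝ≥0∞) = ((n ^ m : ℕ) : ℝ≥0∞) := by
      simp [polyScale]
    have hpos : ((n ^ m : ℕ) : ℝ≥0∞) ≠ 0 := by
      have : n ^ m ≠ 0 := by positivity
      exact_mod_cast this
    rw [hp, ENNReal.le_div_iff_mul_le (Or.inl hpos) (Or.inl (ENNReal.natCast_ne_top _)), one_mul]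
    simpa using ENat.toENNReal_le.2 (h n hn)
  have hpos : 0 < limsup (fun n => (N n : ℝ≥0∞) / (polyScale m n : ℝ≥0∞)) atTop :=
    one_pos.trans_le (le_limsup_of_frequently_le key.frequently)
  simpa [growthExponent] using
    le_iSup₂ (f := fun (χ : ℝ≥0) (_ : 0 < limsup (fun n => (N n : ℝ≥0∞) / (polyScale χ n : ℝ≥0∞))
      atTop) => (χ : ℝ≥0∞)) (m : ℝ≥0) hpos

/-! ### Rotation codings -/

/-- The coding of the orbit of `r` under the rotation `x ↦ x + β` of `ℝ/ℤ`. -/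
def pointCoding (β r : ℝ) : FullShift :=
  fun n => if Int.fract (r + n * β) < 1 - β then 0 else 1

theorem pointCoding_zero (β : ℝ) : pointCoding β 0 = rotationCoding β := by
  funext n
  simp [pointCoding, rotationCoding]

theorem pointCoding_add_intCast (β r : ℝ) (l : ℤ) :
    pointCoding β (r + l) = pointCoding β r := by
  funext n
  simp only [pointCoding, add_right_comm r (l : ℝ), Int.fract_add_intCast]

theorem pointCoding_fract (β r : ℝ) : pointCoding β (Int.fract r) = pointCoding β r := by
  rw [← pointCoding_add_intCast β _ ⌊r⌋, Int.fract_add_floor]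

theorem pointCoding_add_mul (β r : ℝ) (k n : ℤ) :
    pointCoding β (r + k * β) n = pointCoding β r (n + k) := by
  simp only [pointCoding]
  congr 3
  push_cast
  ring

theorem rotationCoding_apply_add (β : ℝ) (k n : ℤ) :
    rotationCoding β (n + k) = pointCoding β (k * β) n := by
  rw [← pointCoding_zero, ← pointCoding_add_mul, zero_add]

/-- The coding records the jumps of `n ↦ ⌊r + nβ⌋`. -/
theorem pointCoding_eq_floor_sub {β : ℝ} (hβ : β ∈ Ioo (0 : ℝ) 1) (r : ℝ) (n : ℤ) :
    ((pointCoding β r n : Fin 2) : ℤ) = ⌊r + (n + 1 : ℤ) * β⌋ - ⌊r + n * β⌋ := by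
  obtain ⟨h0, h1⟩ := hβ
  have e : r + (n + 1 : ℤ) * β = (Int.fract (r + n * β) + β) + (⌊r + n * β⌋ : ℤ) := by
    have := Int.fract_add_floor (r + n * β)
    push_cast
    linarith
  rw [e, Int.floor_add_intCast, add_sub_cancel_right]
  have hf := Int.fract_nonneg (r + n * β)
  have hf' := Int.fract_lt_one (r + n * β)
  unfold pointCoding
  split_ifs with h
  · symm
    rw [Fin.val_zero, Int.floor_eq_iff]
    constructor <;> push_cast <;> linarith
  · symm
    rw [Fin.val_one, Int.floor_eq_iff]
    constructor <;> push_cast <;> linarith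

theorem fin_two_eq_of_intCast_eq {a b : Fin 2} (h : ((a : ℕ) : ℤ) = (b : ℕ)) : a = b :=
  Fin.ext (by exact_mod_cast h)

theorem pointCoding_eq_of_floor_eq {β : ℝ} (hβ : β ∈ Ioo (0 : ℝ) 1) {r r' : ℝ} {n : ℤ}
    (h : ⌊r + n * β⌋ = ⌊r' + n * β⌋) (h' : ⌊r + (n + 1 : ℤ) * β⌋ = ⌊r' + (n + 1 : ℤ) * β⌋) :
    pointCoding β r n = pointCoding β r' n := by
  apply fin_two_eq_of_intCast_eq
  rw [pointCoding_eq_floor_sub hβ, pointCoding_eq_floor_sub hβ, h, h']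

theorem exists_intCast_add_mul_mem_Ioo {β : ℝ} (hirr : Irrational β) {a b : ℝ} (hab : a < b) :
    ∃ k l : ℤ, l + k * β ∈ Ioo a b := by
  have hd : Dense (AddSubgroup.closure {β, (1 : ℝ)} : Set ℝ) :=
    dense_addSubgroupClosure_pair_iff.2 (by simpa using hirr)
  obtain ⟨x, hx, hxm⟩ := hd.exists_between hab
  obtain ⟨k, l, rfl⟩ := AddSubgroup.mem_closure_pair.1 hx
  refine ⟨k, l, ?_⟩
  have : (k • β + l • (1 : ℝ)) = l + k * β := by simp [add_comm]
  rwa [← this]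

/-- The floor is right-continuous, so orbit points approximating `r` must be taken to its right. -/
theorem eventually_floor_add_eq (r c : ℝ) : ∀ᶠ y in 𝓝[>] r, ⌊y + c⌋ = ⌊r + c⌋ := by
  have h : r < ⌊r + c⌋ + 1 - c := by linarith [Int.lt_floor_add_one (r + c)]
  filter_upwards [Ioo_mem_nhdsGT h] with y hy
  rw [Int.floor_eq_iff]
  constructor
  · linarith [Int.floor_le (r + c), hy.1]
  · linarith [hy.2]

/-- Every window of the coding of any point appears in the coding of the orbit of `0`. -/
theorem exists_rotationCoding_eq_pointCoding {β : ℝ} (hβ : β ∈ Ioo (0 : ℝ) 1)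
    (hirr : Irrational β) (r : ℝ) (s : Finset ℤ) :
    ∃ k : ℤ, ∀ n ∈ s, rotationCoding β (n + k) = pointCoding β r n := by
  -- A finite window depends on finitely many floors, so it is constant just to the right of `r`;
  -- density of `ℤ + ℤβ` then finds a point of the orbit of `0` there.
  have hev : ∀ᶠ y in 𝓝[>] r, ∀ n ∈ s, pointCoding β y n = pointCoding β r n := by
    refine (Finset.eventually_all _).2 fun n _ => ?_
    filter_upwards [eventually_floor_add_eq r (n * β),
      eventually_floor_add_eq r ((n + 1 : ℤ) * β)] with y h h'
    exact pointCoding_eq_of_floor_eq hβ h h'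
  obtain ⟨b, hb, hsub⟩ := mem_nhdsGT_iff_exists_Ioo_subset.1 hev
  obtain ⟨k, l, hkl⟩ := exists_intCast_add_mul_mem_Ioo hirr hb
  refine ⟨k, fun n hn => ?_⟩
  rw [rotationCoding_apply_add, ← hsub hkl n hn, add_comm (l : ℝ), pointCoding_add_intCast]

theorem shift_zpow_apply (k : ℤ) (u : FullShift) (n : ℤ) :
    (FullShift.shift ^ k) u n = u (n + k) := by
  induction k generalizing n with
  | zero => simp
  | succ i ih =>
    rw [add_comm (i : ℤ), zpow_add, Homeomorph.mul_apply, zpow_one]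
    change (FullShift.shift ^ (i : ℤ)) u (n + 1) = _
    rw [ih]
    congr 1
    ring
  | pred i ih =>
    rw [sub_eq_add_neg, add_comm (-(i : ℤ)), zpow_add, Homeomorph.mul_apply, zpow_neg_one]
    change (FullShift.shift ^ (-(i : ℤ))) u (n - 1) = _
    rw [ih]
    congr 1
    ring

/-- A sequence lies in the orbit closure of `u` iff all its windows appear in `u`. -/
theorem mem_orbitClosure_iff {u x : FullShift} :
    x ∈ orbitClosure u ↔ ∀ s : Finset ℤ, ∃ k : ℤ, ∀ n ∈ s, u (n + k) = x n := by
  constructor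
  · intro hx s
    obtain ⟨_, ⟨k, rfl⟩, hk⟩ := Metric.mem_closure_iff.1 hx ((1 / 2) ^ s.sup Int.natAbs)
      (by positivity)
    rw [FullShift.dist_lt_iff] at hk
    refine ⟨k, fun n hn => ?_⟩
    obtain ⟨h₁, h₂⟩ := hk n.natAbs (Finset.le_sup (f := Int.natAbs) hn)
    simp only [shift_zpow_apply] at h₁ h₂
    rcases Int.natAbs_eq n with h | h
    · rw [h]; exact h₁.symm
    · rw [h]; exact h₂.symm
  · intro h
    refine Metric.mem_closure_iff.2 fun ε hε => ?_
    obtain ⟨N, hN⟩ := exists_pow_lt_of_lt_one hε (show (1 / 2 : ℝ) < 1 by norm_num)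
    obtain ⟨k, hk⟩ := h (Finset.Icc (-N : ℤ) N)
    refine ⟨_, ⟨k, rfl⟩, lt_trans ((FullShift.dist_lt_iff N).2 fun i hi => ?_) hN⟩
    simp only [shift_zpow_apply]
    constructor
    · exact (hk _ (by simp; omega)).symm
    · exact (hk _ (by simp; omega)).symm

theorem pointCoding_mem_orbitClosure {β : ℝ} (hβ : β ∈ Ioo (0 : ℝ) 1) (hirr : Irrational β)
    (r : ℝ) : pointCoding β r ∈ orbitClosure (rotationCoding β) :=
  mem_orbitClosure_iff.2 (exists_rotationCoding_eq_pointCoding hβ hirr r)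

/-! ### Rotation codings are Sturmian -/

/-- The first `n` letters of a sequence. -/
def prefixWord (n : ℕ) (x : FullShift) : Fin n → Fin 2 := fun j => x (j : ℕ)

theorem words_rotationCoding {β : ℝ} (hβ : β ∈ Ioo (0 : ℝ) 1) (hirr : Irrational β) (n : ℕ) :
    words (rotationCoding β) n = (fun r => prefixWord n (pointCoding β r)) '' Ico 0 1 := by
  ext w
  constructor
  · rintro ⟨k, hk⟩
    refine ⟨Int.fract (k * β), ⟨Int.fract_nonneg _, Int.fract_lt_one _⟩, funext fun j => ?_⟩
    rw [hk j, add_comm, rotationCoding_apply_add]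
    simp only [prefixWord, pointCoding_fract]
  · rintro ⟨r, -, rfl⟩
    obtain ⟨k, hk⟩ := exists_rotationCoding_eq_pointCoding hβ hirr r
      ((Finset.range n).image fun j : ℕ => (j : ℤ))
    refine ⟨k, fun j => ?_⟩
    rw [add_comm, hk _ (Finset.mem_image_of_mem _ (Finset.mem_range.2 j.2))]
    rfl

/-- As `r` runs over `[0, 1)`, the floor jumps once, at the cut point `1 - Int.fract c`. -/
theorem floor_add_eq_ite {r : ℝ} (hr : r ∈ Ico (0 : ℝ) 1) (c : ℝ) :
    ⌊r + c⌋ = ⌊c⌋ + if 1 - Int.fract c ≤ r then 1 else 0 := by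
  have h := Int.fract_add_floor c
  have h0 := Int.fract_nonneg c
  have h1 := Int.fract_lt_one c
  obtain ⟨hr0, hr1⟩ := hr
  split_ifs with hle <;> rw [Int.floor_eq_iff] <;> constructor <;> push_cast <;> linarith

/-- The letters are the increments of `⌊r + jβ⌋`, which starts at `0`, so the word and the sequence
of floors determine each other. Each floor only records the side of a cut point on which `r` lies:
words of length `n` correspond to the intervals into which `n` points cut `[0, 1)`. -/
theorem prefixWord_pointCoding_eq_iff {β : ℝ} (hβ : β ∈ Ioo (0 : ℝ) 1) {r r' : ℝ}
    (hr : r ∈ Ico (0 : ℝ) 1) (hr' : r' ∈ Ico (0 : ℝ) 1) (n : ℕ) :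
    prefixWord n (pointCoding β r) = prefixWord n (pointCoding β r') ↔
      ∀ j : ℕ, 1 ≤ j → j ≤ n →
        (1 - Int.fract (j * β) ≤ r ↔ 1 - Int.fract (j * β) ≤ r') := by
  have hfloor : ∀ j : ℕ, (⌊r + j * β⌋ = ⌊r' + j * β⌋ ↔
      (1 - Int.fract (j * β) ≤ r ↔ 1 - Int.fract (j * β) ≤ r')) := by
    intro j
    rw [floor_add_eq_ite hr, floor_add_eq_ite hr']
    split_ifs with h h' h' <;> simp only [h, h', add_right_inj] <;> norm_num
  simp only [← hfloor]
  constructor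
  · intro h j _
    induction j with
    | zero => intro _; simp [Int.floor_eq_zero_iff.2 hr, Int.floor_eq_zero_iff.2 hr']
    | succ j ih =>
      intro hj
      have hw := congrArg (fun a : Fin 2 => ((a : ℕ) : ℤ)) (congrFun h ⟨j, hj⟩)
      simp only [prefixWord, pointCoding_eq_floor_sub hβ] at hw
      have hj' : ⌊r + j * β⌋ = ⌊r' + j * β⌋ := by
        rcases Nat.eq_zero_or_pos j with rfl | hpos
        · simp [Int.floor_eq_zero_iff.2 hr, Int.floor_eq_zero_iff.2 hr']
        · exact ih hpos (by omega)
      push_cast at hw ⊢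
      linarith
  · intro h
    funext j
    refine pointCoding_eq_of_floor_eq hβ ?_ ?_
    · rcases Nat.eq_zero_or_pos (j : ℕ) with h0 | hpos
      · simp [h0, Int.floor_eq_zero_iff.2 hr, Int.floor_eq_zero_iff.2 hr']
      · exact_mod_cast h j hpos j.2.le
    · exact_mod_cast h (j + 1) (by omega) j.2

theorem fract_natCast_mul_pos {β : ℝ} (hirr : Irrational β) {j : ℕ} (hj : 1 ≤ j) :
    0 < Int.fract (j * β) := by
  refine (Int.fract_nonneg _).lt_of_ne' fun h => ?_
  obtain ⟨z, hz⟩ := Int.fract_eq_zero_iff.1 h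
  exact (hirr.natCast_mul (by omega : j ≠ 0)).ne_int z hz.symm

theorem fract_natCast_mul_injective {β : ℝ} (hirr : Irrational β) :
    Function.Injective fun j : ℕ => Int.fract (j * β) := by
  intro i j h
  by_contra hne
  obtain ⟨z, hz⟩ := Int.fract_eq_fract.1 h
  have hij : ((i : ℤ) - j) ≠ 0 := by omega
  refine (hirr.intCast_mul hij).ne_int z ?_
  push_cast
  linarith

/-- By irrationality the `n` cut points are distinct and interior; with `0` they are the left
endpoints of `n + 1` intervals, one for each word. -/
theorem ncard_words_rotationCoding {β : ℝ} (hβ : β ∈ Ioo (0 : ℝ) 1) (hirr : Irrational β)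
    (n : ℕ) : (words (rotationCoding β) n).ncard = n + 1 := by
  classical
  set D : Finset ℝ := (Finset.Icc 1 n).image fun j : ℕ => 1 - Int.fract (j * β) with hD
  have hmemD : ∀ t ∈ D, t ∈ Ioo (0 : ℝ) 1 := by
    intro t ht
    obtain ⟨j, hj, rfl⟩ := Finset.mem_image.1 ht
    have := fract_natCast_mul_pos hirr (Finset.mem_Icc.1 hj).1
    have := Int.fract_lt_one (j * β)
    constructor <;> linarith
  have h0 : (0 : ℝ) ∉ D := fun h => lt_irrefl _ (hmemD 0 h).1
  have hcard : (insert 0 D).card = n + 1 := by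
    rw [Finset.card_insert_of_notMem h0, Finset.card_image_of_injective, Nat.card_Icc]
    · omega
    · exact fun i j h => fract_natCast_mul_injective hirr (by simpa using h)
  have hT : ∀ t ∈ insert 0 D, t ∈ Ico (0 : ℝ) 1 := by
    intro t ht
    rcases Finset.mem_insert.1 ht with rfl | ht
    · simp
    · exact Ioo_subset_Ico_self (hmemD t ht)
  have himg : words (rotationCoding β) n =
      (fun r => prefixWord n (pointCoding β r)) '' (insert 0 D : Finset ℝ) := by
    rw [words_rotationCoding hβ hirr]
    refine Subset.antisymm ?_ (image_mono fun t ht => hT t ht)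
    rintro _ ⟨r, hr, rfl⟩
    -- The largest element of `insert 0 D` below `r` is the left endpoint of the interval containing
    -- `r`, hence has the same word.
    have hne : ((insert 0 D).filter (· ≤ r)).Nonempty :=
      ⟨0, Finset.mem_filter.2 ⟨Finset.mem_insert_self _ _, hr.1⟩⟩
    obtain ⟨ht, htr⟩ := Finset.mem_filter.1 (Finset.max'_mem _ hne)
    refine ⟨_, ht, (prefixWord_pointCoding_eq_iff hβ (hT _ ht) hr n).2 fun j hj hjn => ?_⟩
    refine ⟨fun h => h.trans htr, fun h => Finset.le_max' ((insert 0 D).filter (· ≤ r)) _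
      (Finset.mem_filter.2 ⟨?_, h⟩)⟩
    exact Finset.mem_insert_of_mem (Finset.mem_image_of_mem _ (Finset.mem_Icc.2 ⟨hj, hjn⟩))
  -- The larger endpoint `t'` is nonzero, so it is itself a cut point and separates `t` from `t'`.
  have hlt : ∀ t ∈ insert 0 D, ∀ t' ∈ insert 0 D, t < t' →
      prefixWord n (pointCoding β t) ≠ prefixWord n (pointCoding β t') := by
    intro t ht t' ht' h heq
    have ht'D : t' ∈ D := by
      rcases Finset.mem_insert.1 ht' with rfl | h'
      · exact absurd (hT t ht).1 (not_le.2 h)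
      · exact h'
    obtain ⟨j, hj, rfl⟩ := Finset.mem_image.1 ht'D
    obtain ⟨hj1, hjn⟩ := Finset.mem_Icc.1 hj
    have := (prefixWord_pointCoding_eq_iff hβ (hT _ ht) (hT _ ht') n).1 heq j hj1 hjn
    exact absurd (this.2 le_rfl) (not_le.2 h)
  rw [himg, InjOn.ncard_image, ncard_coe_finset, hcard]
  intro t ht t' ht' heq
  rcases lt_trichotomy t t' with h | h | h
  · exact absurd heq (hlt t ht t' ht' h)
  · exact h
  · exact absurd heq.symm (hlt t' ht' t ht h)

/-- A quantity `qx` with `|qx| ≤ C` for all `q : ℕ` vanishes. -/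
theorem eq_zero_of_forall_natCast_mul_le {x C : ℝ} (h : ∀ q : ℕ, |q * x| ≤ C) : x = 0 := by
  by_contra hx
  obtain ⟨q, hq⟩ := exists_nat_gt (C / |x|)
  have := h q
  rw [abs_mul, Nat.abs_cast] at this
  rw [div_lt_iff₀ (abs_pos.2 hx)] at hq
  linarith

/-- After `q` steps the floor has grown by `q * c` and its argument by `q * p * β`; two rounding
errors keep these within `2` of each other for all `q`, which forces `p * β = c`. -/
theorem floor_add_mul_of_periodic {β : ℝ} {N p : ℤ}
    (h : ∀ q : ℕ, ⌊(N + (q + 1 : ℕ) * p : ℤ) * β⌋ - ⌊(N + q * p : ℤ) * β⌋ =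
      ⌊(N + p : ℤ) * β⌋ - ⌊N * β⌋) : ∃ z : ℤ, p * β = z := by
  set c := ⌊(N + p : ℤ) * β⌋ - ⌊N * β⌋ with hc
  have hq : ∀ q : ℕ, ⌊(N + q * p : ℤ) * β⌋ = ⌊N * β⌋ + q * c := by
    intro q
    induction q with
    | zero => simp
    | succ q ih =>
      have := h q
      rw [ih] at this
      push_cast at this ⊢
      linarith
  refine ⟨c, sub_eq_zero.1 (eq_zero_of_forall_natCast_mul_le (C := 2) fun q => ?_)⟩
  have h1 := Int.floor_le ((N + q * p : ℤ) * β)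
  have h2 := Int.lt_floor_add_one ((N + q * p : ℤ) * β)
  have h3 := Int.floor_le (N * β)
  have h4 := Int.lt_floor_add_one (N * β)
  rw [hq] at h1 h2
  push_cast at h1 h2
  rw [abs_le]
  constructor <;> nlinarith

theorem not_exists_intCast_mul_eq {β : ℝ} (hirr : Irrational β) {p : ℤ} (hp : p ≠ 0) :
    ¬ ∃ z : ℤ, p * β = z := by
  rintro ⟨z, hz⟩
  exact (hirr.intCast_mul hp).ne_int z hz

theorem isSturmian_rotationCoding {β : ℝ} (hβ : β ∈ Ioo (0 : ℝ) 1) (hirr : Irrational β) :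
    IsSturmian (rotationCoding β) := by
  have hval : ∀ n : ℤ, ((rotationCoding β n : Fin 2) : ℤ) = ⌊(n + 1 : ℤ) * β⌋ - ⌊n * β⌋ := by
    intro n
    simpa [pointCoding_zero] using pointCoding_eq_floor_sub hβ 0 n
  refine ⟨fun n _ => ncard_words_rotationCoding hβ hirr n, ?_, ?_⟩
  · rintro ⟨p, hp, N, hN⟩
    refine not_exists_intCast_mul_eq hirr hp.ne' (floor_add_mul_of_periodic (N := N) ?_)
    -- Periodicity makes the increment of the floor over `p` steps independent of the starting point
    -- beyond `N`.
    have hstep : ∀ i : ℕ, ⌊(N + i + p : ℤ) * β⌋ - ⌊(N + i : ℤ) * β⌋ =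
        ⌊(N + p : ℤ) * β⌋ - ⌊N * β⌋ := by
      intro i
      induction i with
      | zero => simp
      | succ i ih =>
        have h1 := hval (N + i + p)
        have h2 := hval (N + i)
        rw [hN (N + i) (by omega), h2] at h1
        rw [← ih]
        have e : (N + (i + 1 : ℕ) + p : ℤ) = N + i + p + 1 := by push_cast; ring
        have e' : (N + (i + 1 : ℕ) : ℤ) = N + i + 1 := by push_cast; ring
        rw [e, e']
        linarith
    intro q
    have e := hstep (q * p.toNat)
    have hpn : ((q * p.toNat : ℕ) : ℤ) = q * p := by
      push_cast
      rw [Int.toNat_of_nonneg hp.le]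
    rw [hpn] at e
    rw [← e]
    have e' : (N + (q + 1 : ℕ) * p : ℤ) = N + q * p + p := by push_cast; ring
    rw [e']
  · rintro ⟨p, hp, N, hN⟩
    refine not_exists_intCast_mul_eq hirr (neg_ne_zero.2 hp.ne')
      (floor_add_mul_of_periodic (N := N) ?_)
    -- The same argument run backwards, with step `-p`.
    have hstep : ∀ i : ℕ, ⌊(N - i + -p : ℤ) * β⌋ - ⌊(N - i : ℤ) * β⌋ =
        ⌊(N + -p : ℤ) * β⌋ - ⌊N * β⌋ := by
      intro i
      induction i with
      | zero => simp
      | succ i ih =>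
        have h1 := hval (N - (i + 1 : ℕ) - p)
        have h2 := hval (N - (i + 1 : ℕ))
        rw [hN (N - (i + 1 : ℕ)) (by omega), h2] at h1
        rw [← ih]
        have e : (N - (i + 1 : ℕ) - p + 1 : ℤ) = N - i + -p := by push_cast; ring
        have e' : (N - (i + 1 : ℕ) + 1 : ℤ) = N - i := by push_cast; ring
        rw [e, e'] at h1
        rw [← sub_eq_add_neg (N - ((i + 1 : ℕ) : ℤ))]
        linarith
    intro q
    have e := hstep (q * p.toNat)
    have hpn : ((q * p.toNat : ℕ) : ℤ) = q * p := by
      push_cast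
      rw [Int.toNat_of_nonneg hp.le]
    rw [hpn] at e
    rw [← e]
    have e' : (N + (q + 1 : ℕ) * -p : ℤ) = N - q * p + -p := by push_cast; ring
    have e'' : (N + q * -p : ℤ) = N - q * p := by ring
    rw [e', e'']

/-! ### Topological slow entropy of products of Sturmian systems -/

theorem productShift_iterate_apply {m : ℕ} (u : Fin m → FullShift) (x : ProductSpace u) (s : ℕ)
    (i : Fin m) (n : ℤ) :
    (((productShift u)^[s] x i : orbitClosure (u i)) : FullShift) n =
      (x i : FullShift) (n + s) := by
  induction s generalizing x with
  | zero => simp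
  | succ s ih =>
    rw [Function.iterate_succ_apply, ih]
    exact congrArg (fun c : ℤ => (x i : FullShift) c) (by push_cast; ring)

theorem window_mem_words {u x : FullShift} (hx : x ∈ orbitClosure u) (a : ℤ) (L : ℕ) :
    (fun j : Fin L => x (a + (j : ℕ))) ∈ words u L := by
  obtain ⟨k, hk⟩ := mem_orbitClosure_iff.1 hx (Finset.univ.image fun j : Fin L => a + (j : ℕ))
  refine ⟨a + k, fun j => ?_⟩
  exact (hk _ (Finset.mem_image_of_mem _ (Finset.mem_univ j))).symm.trans
    (congrArg (fun c : ℤ => u c) (by ring))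

theorem self_shift_mem_orbitClosure (u : FullShift) (k : ℤ) :
    (FullShift.shift ^ k) u ∈ orbitClosure u :=
  subset_closure ⟨k, rfl⟩

instance (u : FullShift) : CompactSpace (orbitClosure u) :=
  isCompact_iff_compactSpace.1 isClosed_closure.isCompact

/-- The words of length `L` starting at position `a` in each coordinate. -/
def windows {m : ℕ} (u : Fin m → FullShift) (a : ℤ) (L : ℕ) (x : ProductSpace u) :
    ∀ i, words (u i) L :=
  fun i => ⟨_, window_mem_words (x i).2 a L⟩

theorem dist_iterate_lt_iff {m : ℕ} (u : Fin m → FullShift) (x y : ProductSpace u) (s k : ℕ) :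
    dist ((productShift u)^[s] x) ((productShift u)^[s] y) < (1 / 2) ^ k ↔
      ∀ i, ∀ j : ℕ, j ≤ k → (x i : FullShift) (j + s) = (y i : FullShift) (j + s) ∧
        (x i : FullShift) (-j + s) = (y i : FullShift) (-j + s) := by
  rw [dist_pi_lt_iff (by positivity)]
  simp only [Subtype.dist_eq, FullShift.dist_lt_iff, productShift_iterate_apply]

/-- Points that agree on `[-k, n + k)` in every coordinate stay within `(1 / 2) ^ k` for `n` steps,
so one centre per tuple of words of length `n + 2 * k` suffices. -/
theorem coverNumber_le {m : ℕ} (u : Fin m → FullShift) (K : Set (ProductSpace u)) {ε : ℝ} {k : ℕ}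
    (hk : (1 / 2 : ℝ) ^ k < ε) (n : ℕ) :
    coverNumber (productShift u) K ε n ≤ ((∏ i, (words (u i) (n + 2 * k)).ncard : ℕ) : ℕ∞) := by
  classical
  set W := windows u (-k) (n + 2 * k) with hW
  have : Nonempty (ProductSpace u) :=
    ⟨fun i => ⟨_, self_shift_mem_orbitClosure (u i) 0⟩⟩
  have := Fintype.ofFinite (∀ i, words (u i) (n + 2 * k))
  let s : Finset (ProductSpace u) := Finset.univ.image (Function.invFun W)
  have hs : Dynamics.IsDynCoverOf (productShift u) K {p | dist p.1 p.2 < ε} n s := by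
    intro x _
    refine ⟨Function.invFun W (W x), by simp [s], Dynamics.mem_dynEntourage.2 fun t ht => ?_⟩
    have hWx : W (Function.invFun W (W x)) = W x := Function.invFun_eq ⟨x, rfl⟩
    refine lt_trans ((dist_iterate_lt_iff u _ _ t k).2 fun i j hj => ?_) hk
    have key : ∀ c : ℤ, -k ≤ c → c < n + k →
        (x i : FullShift) c = (Function.invFun W (W x) i : FullShift) c := by
      intro c hc hc'
      have h := congrFun (congrArg Subtype.val (congrFun hWx i)) ⟨(c + k).toNat, by omega⟩
      have e : (-k + ((c + k).toNat : ℤ)) = c := by omega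
      simp only [hW, windows, e] at h
      exact h.symm
    exact ⟨key _ (by omega) (by omega), key _ (by omega) (by omega)⟩
  refine hs.coverMincard_le_card.trans (Nat.cast_le.2 (Finset.card_image_le.trans (le_of_eq ?_)))
  rw [Finset.card_univ, ← Nat.card_eq_fintype_card, Nat.card_pi]
  rfl

/-- Distance less than `1` forces agreement at position `0`, so each Bowen ball fixes the first `n`
letters in every coordinate. All tuples of words occur, since the coordinates can be shifted
independently. -/
theorem le_coverNumber {m : ℕ} (u : Fin m → FullShift) {ε : ℝ} (hε : ε ≤ 1) (n : ℕ) :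
    ((∏ i, (words (u i) n).ncard : ℕ) : ℕ∞) ≤ coverNumber (productShift u) univ ε n := by
  refine le_iInf₂ fun s hs => Nat.cast_le.2 ?_
  have hex : ∀ w : ∀ i, words (u i) n, ∃ z : s, windows u 0 n z = w := by
    intro w
    choose k hk using fun i => (w i).2
    obtain ⟨z, hz, hyz⟩ := hs (mem_univ fun i =>
      (⟨_, self_shift_mem_orbitClosure (u i) (k i)⟩ : orbitClosure (u i)))
    refine ⟨⟨z, hz⟩, funext fun i => Subtype.ext (funext fun j => ?_)⟩
    have h := Dynamics.mem_dynEntourage.1 hyz j j.2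
    have h' := ((dist_iterate_lt_iff u _ _ j 0).1
      (lt_of_lt_of_le h (by simpa using hε)) i 0 le_rfl).1
    rw [hk i j]
    simp only [shift_zpow_apply] at h'
    simp only [windows]
    rw [add_comm (k i)]
    simpa using h'.symm
  choose z hz using hex
  have hinj : Function.Injective z := fun w w' h => by rw [← hz w, ← hz w', h]
  have := Nat.card_le_card_of_injective z hinj
  rw [Nat.card_pi, Nat.card_eq_fintype_card, Fintype.card_coe] at this
  exact this

theorem topSlowEntropy_productShift {m : ℕ} {u : Fin m → FullShift} (hu : ∀ i, IsSturmian (u i)) :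
    topSlowEntropy polyScale (productShift u) = m := by
  refine le_antisymm (iSup₂_le fun K _ => ?_) ?_
  · refine limsup_le_of_le (h := ?_)
    filter_upwards [self_mem_nhdsWithin] with ε (hε : 0 < ε)
    obtain ⟨k, hk⟩ := exists_pow_lt_of_lt_one hε (show (1 / 2 : ℝ) < 1 by norm_num)
    -- The constant comes from `n + 2 * k + 1 ≤ (2 * k + 2) * n` for `n ≥ 1`.
    refine growthExponent_le_of_le_mul_pow m ((2 * k + 2) ^ m) fun n hn => ?_
    refine (coverNumber_le u K hk n).trans (Nat.cast_le.2 ?_)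
    rw [Finset.prod_congr rfl fun i _ => (hu i).complexity (n + 2 * k) (by omega)]
    rw [Finset.prod_const, Finset.card_univ, Fintype.card_fin, ← mul_pow]
    exact Nat.pow_le_pow_left (by nlinarith) m
  · refine le_iSup₂_of_le univ isCompact_univ (le_limsup_of_frequently_le ?_)
    refine Eventually.frequently ?_
    filter_upwards [Ioc_mem_nhdsGT zero_lt_one] with ε hε
    refine le_growthExponent_of_pow_le m fun n hn => ?_
    refine le_trans (Nat.cast_le.2 ?_) (le_coverNumber u hε.2 n)
    rw [Finset.prod_congr rfl fun i _ => (hu i).complexity n hn]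
    rw [Finset.prod_const, Finset.card_univ, Fintype.card_fin]
    exact Nat.pow_le_pow_left (by omega) m

/-! ### Unique ergodicity of rotations of the torus -/

/-- The point of the torus `(ℝ/ℤ)^m` represented by a vector. -/
def torusPoint {m : ℕ} (β : Fin m → ℝ) : UnitAddTorus (Fin m) := fun i => (β i : UnitAddCircle)

theorem mFourier_torusPoint {m : ℕ} (β : Fin m → ℝ) (k : Fin m → ℤ) :
    UnitAddTorus.mFourier k (torusPoint β) =
      Complex.exp (2 * Real.pi * Complex.I * (∑ i, k i * β i : ℝ)) := by
  change ∏ i, fourier (k i) ((β i : ℝ) : UnitAddCircle) = _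
  simp only [fourier_coe_apply]
  rw [← Complex.exp_sum]
  congr 1
  push_cast
  rw [Finset.mul_sum]
  refine Finset.sum_congr rfl fun i _ => ?_
  ring

theorem mFourier_apply_add {m : ℕ} (k : Fin m → ℤ) (x y : UnitAddTorus (Fin m)) :
    UnitAddTorus.mFourier k (x + y) = UnitAddTorus.mFourier k x * UnitAddTorus.mFourier k y := by
  change ∏ i, fourier (k i) (x i + y i) = (∏ i, fourier (k i) (x i)) * ∏ i, fourier (k i) (y i)
  rw [← Finset.prod_mul_distrib]
  refine Finset.prod_congr rfl fun i _ => ?_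
  simp [fourier_apply, smul_add, AddCircle.toCircle_add]

/-- This is what independence is needed for: no nontrivial character of the torus is trivial at
`torusPoint β`. -/
theorem sum_mul_ne_intCast {m : ℕ} {β : Fin m → ℝ}
    (hβ : LinearIndependent ℚ (Fin.cons 1 β : Fin (m + 1) → ℝ)) {k : Fin m → ℤ} (hk : k ≠ 0)
    (z : ℤ) : ∑ i, k i * β i ≠ (z : ℝ) := by
  intro h
  obtain ⟨i, hi⟩ := Function.ne_iff.1 hk
  have := Fintype.linearIndependent_iff.1 hβ
    (Fin.cons (-z : ℚ) fun i => (k i : ℚ)) (by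
      rw [Fin.sum_univ_succ]
      simp only [Fin.cons_zero, Fin.cons_succ, Rat.smul_def]
      push_cast
      linarith) i.succ
  simp only [Fin.cons_succ] at this
  exact hi (by exact_mod_cast this)

theorem irrational_of_linearIndependent {m : ℕ} {β : Fin m → ℝ}
    (hβ : LinearIndependent ℚ (Fin.cons 1 β : Fin (m + 1) → ℝ)) (i : Fin m) :
    Irrational (β i) := by
  rintro ⟨q, hq⟩
  have hk : (Pi.single i (q.den : ℤ) : Fin m → ℤ) ≠ 0 := by
    simp [Pi.single_eq_zero_iff]
  refine sum_mul_ne_intCast hβ hk q.num ?_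
  rw [Finset.sum_eq_single i]
  · rw [← hq, Pi.single_eq_same]
    exact_mod_cast Rat.den_mul_eq_num q
  · intro j _ hj
    simp [Pi.single_eq_of_ne hj]
  · simp

/-- Invariance multiplies the integral of a character by its value at `torusPoint β`, which is not
`1`. -/
theorem integral_mFourier_eq_zero {m : ℕ} {β : Fin m → ℝ}
    (hβ : LinearIndependent ℚ (Fin.cons 1 β : Fin (m + 1) → ℝ))
    {ν : Measure (UnitAddTorus (Fin m))}
    (hν : MeasurePreserving (· + torusPoint β) ν ν) {k : Fin m → ℤ} (hk : k ≠ 0) :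
    ∫ x, UnitAddTorus.mFourier k x ∂ν = 0 := by
  have h : ∫ x, UnitAddTorus.mFourier k (x + torusPoint β) ∂ν =
      ∫ x, UnitAddTorus.mFourier k x ∂ν :=
    hν.integral_comp (MeasurableEquiv.addRight (torusPoint β)).measurableEmbedding _
  simp only [mFourier_apply_add] at h
  rw [integral_mul_const] at h
  have hne : UnitAddTorus.mFourier k (torusPoint β) ≠ 1 := by
    rw [mFourier_torusPoint]
    intro h1
    obtain ⟨z, hz⟩ := Complex.exp_eq_one_iff.1 h1
    rw [mul_comm] at hz
    have := mul_right_cancel₀ Complex.two_pi_I_ne_zero hz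
    exact sum_mul_ne_intCast hβ hk z (by exact_mod_cast this)
  by_contra h0
  exact hne (mul_left_cancel₀ h0 (h.trans (mul_one _).symm))

/-- The two measures have the same Fourier coefficients; trigonometric polynomials are uniformly
dense and integration is continuous in the uniform norm. -/
theorem eq_of_measurePreserving_add_torusPoint {m : ℕ} {β : Fin m → ℝ}
    (hβ : LinearIndependent ℚ (Fin.cons 1 β : Fin (m + 1) → ℝ))
    {ν ν' : Measure (UnitAddTorus (Fin m))} [IsProbabilityMeasure ν] [IsProbabilityMeasure ν']
    (hν : MeasurePreserving (· + torusPoint β) ν ν)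
    (hν' : MeasurePreserving (· + torusPoint β) ν' ν') : ν = ν' := by
  have hint : ∀ (ρ : Measure (UnitAddTorus (Fin m))) [IsProbabilityMeasure ρ]
      (f : C(UnitAddTorus (Fin m), ℂ)), Integrable f ρ := fun ρ _ f =>
    (BoundedContinuousFunction.mkOfCompact f).integrable ρ
  have hcont : ∀ (ρ : Measure (UnitAddTorus (Fin m))) [IsProbabilityMeasure ρ],
      Continuous fun f : C(UnitAddTorus (Fin m), ℂ) => ∫ x, f x ∂ρ := by
    intro ρ _
    refine LipschitzWith.continuous (K := 1) (LipschitzWith.of_dist_le_mul fun f g => ?_)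
    rw [dist_eq_norm, ← integral_sub (hint ρ f) (hint ρ g), NNReal.coe_one, one_mul, dist_eq_norm]
    refine (norm_integral_le_of_norm_le_const (C := ‖f - g‖) ?_).trans (by simp)
    exact Eventually.of_forall fun x => (f - g).norm_coe_le_norm x
  have heq : ∀ f : C(UnitAddTorus (Fin m), ℂ), ∫ x, f x ∂ν = ∫ x, f x ∂ν' := by
    intro f
    have hclosed : IsClosed {f : C(UnitAddTorus (Fin m), ℂ) | ∫ x, f x ∂ν = ∫ x, f x ∂ν'} :=
      isClosed_eq (hcont ν) (hcont ν')
    have hspan : ((Submodule.span ℂ (range (UnitAddTorus.mFourier (d := Fin m))) :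
        Submodule ℂ C(UnitAddTorus (Fin m), ℂ)) : Set C(UnitAddTorus (Fin m), ℂ)) ⊆ {f | ∫ x, f x ∂ν = ∫ x, f x ∂ν'} := by
      intro g hg
      induction hg using Submodule.span_induction with
      | mem g hg =>
        obtain ⟨k, rfl⟩ := hg
        by_cases hk : k = 0
        · subst hk
          simp [UnitAddTorus.mFourier_zero]
        · exact (integral_mFourier_eq_zero hβ hν hk).trans
            (integral_mFourier_eq_zero hβ hν' hk).symm
      | zero => simp
      | add g h _ _ ihg ihh =>
        change ∫ x, (g x + h x) ∂ν = ∫ x, (g x + h x) ∂ν'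
        rw [integral_add (hint ν g) (hint ν h), integral_add (hint ν' g) (hint ν' h), ihg, ihh]
      | smul c g _ ihg =>
        change ∫ x, (c • g x) ∂ν = ∫ x, (c • g x) ∂ν'
        rw [integral_smul, integral_smul, ihg]
    have hf : f ∈ (Submodule.span ℂ (range UnitAddTorus.mFourier)).topologicalClosure := by
      rw [UnitAddTorus.span_mFourier_closure_eq_top]
      trivial
    exact hclosed.closure_subset_iff.2 hspan hf
  refine ext_of_forall_integral_eq_of_IsFiniteMeasure fun f => ?_
  have := heq ⟨fun x => (f x : ℂ), by fun_prop⟩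
  simp only [ContinuousMap.coe_mk, integral_complex_ofReal] at this
  exact_mod_cast this

/-! ### The phase of a point of a Sturmian system -/

/-- The sum `x_0 + ⋯ + x_{n-1}`, extended to negative `n`. -/
def cumSum (x : FullShift) (n : ℤ) : ℤ :=
  ∑ j ∈ Finset.Ico 0 n, ((x j : Fin 2) : ℤ) - ∑ j ∈ Finset.Ico n 0, ((x j : Fin 2) : ℤ)

theorem cumSum_zero (x : FullShift) : cumSum x 0 = 0 := by simp [cumSum]

theorem cumSum_add_one (x : FullShift) (n : ℤ) :
    cumSum x (n + 1) = cumSum x n + ((x n : Fin 2) : ℤ) := by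
  rcases le_or_gt 0 n with h | h
  · have e : Finset.Ico 0 (n + 1) = insert n (Finset.Ico 0 n) := by
      ext j; simp only [Finset.mem_Ico, Finset.mem_insert]; omega
    rw [cumSum, cumSum, e, Finset.sum_insert (by simp), Finset.Ico_eq_empty_of_le h,
      Finset.Ico_eq_empty_of_le (by omega : (0 : ℤ) ≤ n + 1)]
    ring
  · have e : Finset.Ico n 0 = insert n (Finset.Ico (n + 1) 0) := by
      ext j; simp only [Finset.mem_Ico, Finset.mem_insert]; omega
    rw [cumSum, cumSum, e, Finset.sum_insert (by simp), Finset.Ico_eq_empty_of_le h.le,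
      Finset.Ico_eq_empty_of_le (by omega : n + 1 ≤ 0)]
    ring

theorem cumSum_eq_of_forall {x : FullShift} {g : ℤ → ℤ} (h0 : g 0 = 0)
    (h : ∀ n, g (n + 1) = g n + ((x n : Fin 2) : ℤ)) (n : ℤ) : cumSum x n = g n := by
  induction n with
  | zero => rw [cumSum_zero, h0]
  | succ i ih => rw [cumSum_add_one, h, ih]
  | pred i ih =>
    have h1 := cumSum_add_one x (-i - 1)
    have h2 := h (-i - 1)
    rw [sub_add_cancel] at h1 h2
    omega

theorem cumSum_shift (x : FullShift) (n : ℤ) :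
    cumSum (FullShift.shift x) n = cumSum x (n + 1) - ((x 0 : Fin 2) : ℤ) := by
  refine cumSum_eq_of_forall (g := fun n => cumSum x (n + 1) - ((x 0 : Fin 2) : ℤ)) ?_ ?_ n
  · rw [cumSum_add_one, cumSum_zero]
    ring
  · intro n
    change cumSum x (n + 1 + 1) - ((x 0 : Fin 2) : ℤ) =
      cumSum x (n + 1) - ((x 0 : Fin 2) : ℤ) + ((x (n + 1) : Fin 2) : ℤ)
    rw [cumSum_add_one x (n + 1)]
    ring

theorem cumSum_pointCoding {β : ℝ} (hβ : β ∈ Ioo (0 : ℝ) 1) (r : ℝ) (n : ℤ) :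
    cumSum (pointCoding β r) n = ⌊r + n * β⌋ - ⌊r⌋ := by
  refine cumSum_eq_of_forall (g := fun n => ⌊r + n * β⌋ - ⌊r⌋) (by simp) (fun n => ?_) n
  simp only [pointCoding_eq_floor_sub hβ]
  ring

theorem cumSum_congr {x y : FullShift} {N n : ℤ} (h : ∀ j ∈ Finset.Icc (-N) N, x j = y j)
    (hn : n ∈ Finset.Icc (-N) N) : cumSum x n = cumSum y n := by
  rw [Finset.mem_Icc] at hn
  unfold cumSum
  congr 1 <;> refine Finset.sum_congr rfl fun j hj => ?_ <;>
    rw [Finset.mem_Ico] at hj <;> rw [h j (Finset.mem_Icc.2 ⟨by omega, by omega⟩)]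

/-- For the coding of `r`, the left side is at most `Int.fract r` and the right side exceeds it. For
given `n` and `l` the inequality involves a finite window only, so it passes to the orbit closure.
It makes the supremum defining `phase` finite and bounds it above. -/
theorem cumSum_sub_lt {β : ℝ} (hβ : β ∈ Ioo (0 : ℝ) 1) {x : FullShift}
    (hx : x ∈ orbitClosure (rotationCoding β)) (n l : ℤ) :
    (cumSum x n : ℝ) - n * β < cumSum x l + 1 - l * β := by
  set N : ℤ := max |n| |l| with hN
  have hn : n ∈ Finset.Icc (-N) N := Finset.mem_Icc.2 (abs_le.1 (le_max_left _ _))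
  have hl : l ∈ Finset.Icc (-N) N := Finset.mem_Icc.2 (abs_le.1 (le_max_right _ _))
  obtain ⟨k, hk⟩ := mem_orbitClosure_iff.1 hx (Finset.Icc (-N) N)
  have hk' : ∀ j ∈ Finset.Icc (-N) N, x j = pointCoding β (k * β) j := fun j hj => by
    rw [← hk j hj, rotationCoding_apply_add]
  rw [cumSum_congr hk' hn, cumSum_congr hk' hl, cumSum_pointCoding hβ, cumSum_pointCoding hβ]
  push_cast
  linarith [Int.floor_le (k * β + n * β), Int.lt_floor_add_one (k * β + l * β)]

/-- The point of `ℝ/ℤ`, represented by a real number, of which a point of the Sturmian system is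
a coding. -/
def phase (β : ℝ) (x : FullShift) : ℝ := ⨆ n : ℤ, ((cumSum x n : ℝ) - n * β)

theorem bddAbove_cumSum {β : ℝ} (hβ : β ∈ Ioo (0 : ℝ) 1) {x : FullShift}
    (hx : x ∈ orbitClosure (rotationCoding β)) :
    BddAbove (range fun n : ℤ => (cumSum x n : ℝ) - n * β) := by
  refine ⟨1, ?_⟩
  rintro _ ⟨n, rfl⟩
  simpa [cumSum_zero] using (cumSum_sub_lt hβ hx n 0).le

theorem cumSum_le_phase_add {β : ℝ} (hβ : β ∈ Ioo (0 : ℝ) 1) {x : FullShift}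
    (hx : x ∈ orbitClosure (rotationCoding β)) (n : ℤ) : cumSum x n ≤ phase β x + n * β :=
  sub_le_iff_le_add.1 (le_ciSup (bddAbove_cumSum hβ hx) n)

theorem phase_add_le_cumSum {β : ℝ} (hβ : β ∈ Ioo (0 : ℝ) 1) {x : FullShift}
    (hx : x ∈ orbitClosure (rotationCoding β)) (n : ℤ) :
    phase β x + n * β ≤ cumSum x n + 1 := by
  have : phase β x ≤ cumSum x n + 1 - n * β := ciSup_le fun l => (cumSum_sub_lt hβ hx l n).le
  linarith

/-- Shifting reindexes the supremum. Modulo `1` the last term vanishes, so `phase` intertwines the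
shift with the rotation. -/
theorem phase_shift {β : ℝ} (hβ : β ∈ Ioo (0 : ℝ) 1) {x : FullShift}
    (hx : x ∈ orbitClosure (rotationCoding β)) :
    phase β (FullShift.shift x) = phase β x + β - ((x 0 : Fin 2) : ℕ) := by
  have e : ∀ n : ℤ, (cumSum (FullShift.shift x) n : ℝ) - n * β =
      (cumSum x (n + 1) - (n + 1 : ℤ) * β) + (β - ((x 0 : Fin 2) : ℕ)) := by
    intro n
    rw [cumSum_shift]
    push_cast
    ring
  have hb : BddAbove (range fun n : ℤ => (cumSum x (n + 1) : ℝ) - (n + 1 : ℤ) * β) :=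
    (bddAbove_cumSum hβ hx).mono 
      (range_comp_subset_range (fun n : ℤ => n + 1) fun n : ℤ => (cumSum x n : ℝ) - n * β)
  have hs : ⨆ n : ℤ, ((cumSum x (n + 1) : ℝ) - (n + 1 : ℤ) * β) = phase β x :=
    (Equiv.addRight (1 : ℤ)).iSup_comp (g := fun n : ℤ => (cumSum x n : ℝ) - n * β)
  rw [phase, iSup_congr e, ← ciSup_add hb, hs]
  ring

/-- The phase satisfies `cumSum x n ≤ phase β x + n * β ≤ cumSum x n + 1`. Equality on the right
would put it in the orbit of `0`; otherwise `cumSum x n` is the floor, and its increments are the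
letters of `x`. -/
theorem pointCoding_phase {β : ℝ} (hβ : β ∈ Ioo (0 : ℝ) 1) {x : FullShift}
    (hx : x ∈ orbitClosure (rotationCoding β))
    (hp : ((phase β x : ℝ) : UnitAddCircle) ∉ range fun n : ℤ => ((n * β : ℝ) : UnitAddCircle)) :
    pointCoding β (phase β x) = x := by
  have hfl : ∀ n : ℤ, ⌊phase β x + n * β⌋ = cumSum x n := by
    intro n
    refine Int.floor_eq_iff.2 ⟨cumSum_le_phase_add hβ hx n,
      (phase_add_le_cumSum hβ hx n).lt_of_ne fun h => hp ⟨-n, ?_⟩⟩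
    have e : phase β x = ((-n : ℤ) : ℝ) * β + ((cumSum x n + 1 : ℤ) : ℝ) := by
      push_cast
      linarith
    have hz : (((cumSum x n + 1 : ℤ) : ℝ) : UnitAddCircle) = 0 :=
      (AddCircle.coe_eq_zero_iff 1).2 ⟨cumSum x n + 1, by simp⟩
    simp only
    rw [e, AddCircle.coe_add, hz, add_zero]
  funext n
  refine fin_two_eq_of_intCast_eq ?_
  rw [pointCoding_eq_floor_sub hβ, hfl, hfl, cumSum_add_one]
  ring

/-! ### Measurability -/

theorem measurable_fullShift_iff {Y : Type*} [MeasurableSpace Y] {g : Y → FullShift} :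
    Measurable g ↔ ∀ n : ℤ, Measurable fun y => g y n := by
  have h : borel FullShift = (MeasurableSpace.pi : MeasurableSpace (ℤ → Fin 2)) :=
    (Pi.borelSpace (X := fun _ : ℤ => Fin 2)).measurable_eq.symm
  change @Measurable Y FullShift _ (borel FullShift) g ↔ _
  rw [h]
  exact measurable_pi_iff (X := fun _ : ℤ => Fin 2)

theorem measurable_fullShift_apply (n : ℤ) : Measurable fun x : FullShift => x n :=
  measurable_fullShift_iff.1 measurable_id n

theorem measurable_phase (β : ℝ) : Measurable (phase β) := by
  refine Measurable.iSup fun n => ?_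
  have h : Measurable fun x : FullShift => cumSum x n := by
    refine Measurable.sub ?_ ?_ <;>
      exact Finset.measurable_sum _ fun j _ =>
        (measurable_of_finite fun a : Fin 2 => ((a : ℕ) : ℤ)).comp (measurable_fullShift_apply j)
  exact ((measurable_of_countable fun z : ℤ => (z : ℝ)).comp h).sub_const _

theorem measurable_pointCoding (β : ℝ) : Measurable (pointCoding β) := by
  refine measurable_fullShift_iff.2 fun n => ?_
  refine Measurable.ite ?_ measurable_const measurable_const
  exact measurableSet_lt (measurable_fract.comp (measurable_id.add_const _)) measurable_const

/-- The coding of a point of the circle. -/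
def circleCoding (β : ℝ) (x : UnitAddCircle) : FullShift :=
  pointCoding β (AddCircle.equivIco 1 0 x)

theorem circleCoding_coe (β r : ℝ) : circleCoding β (r : UnitAddCircle) = pointCoding β r := by
  rw [circleCoding, AddCircle.coe_equivIco_mk_apply]
  simp [pointCoding_fract]

theorem measurable_circleCoding (β : ℝ) : Measurable (circleCoding β) :=
  (measurable_pointCoding β).comp
    (measurable_subtype_coe.comp (AddCircle.measurableEquivIco (1 : ℝ) 0).measurable)

theorem circleCoding_add (β : ℝ) (x : UnitAddCircle) :
    circleCoding β (x + (β : UnitAddCircle)) = FullShift.shift (circleCoding β x) := by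
  obtain ⟨r, rfl⟩ := QuotientAddGroup.mk_surjective x
  change circleCoding β ((r + β : ℝ) : UnitAddCircle) =
    FullShift.shift (circleCoding β (r : UnitAddCircle))
  rw [circleCoding_coe, circleCoding_coe]
  funext n
  have := pointCoding_add_mul β r 1 n
  rwa [Int.cast_one, one_mul] at this

/-! ### Unique ergodicity of products of Sturmian systems -/

instance : IsProbabilityMeasure (volume : Measure UnitAddCircle) :=
  ⟨by rw [AddCircle.measure_univ, ENNReal.ofReal_one]⟩

instance : NullSingletonClass (volume : Measure UnitAddCircle) :=
  ⟨fun x => measure_mono_null (t := Metric.closedBall x 0) (by simp) (by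
    rw [AddCircle.volume_closedBall]
    simp)⟩

section Product

variable {m : ℕ} {β : Fin m → ℝ}

/-- The coding of a point of the torus. -/
def torusCoding (hβ : ∀ i, β i ∈ Ioo (0 : ℝ) 1) (hirr : ∀ i, Irrational (β i))
    (x : UnitAddTorus (Fin m)) : ProductSpace fun i => rotationCoding (β i) :=
  fun i => ⟨circleCoding (β i) (x i), pointCoding_mem_orbitClosure (hβ i) (hirr i) _⟩

theorem measurable_torusCoding (hβ : ∀ i, β i ∈ Ioo (0 : ℝ) 1) (hirr : ∀ i, Irrational (β i)) :
    Measurable (torusCoding hβ hirr) :=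
  measurable_pi_iff.2 fun i =>
    ((measurable_circleCoding (β i)).comp (measurable_pi_apply i)).subtype_mk

theorem torusCoding_add (hβ : ∀ i, β i ∈ Ioo (0 : ℝ) 1) (hirr : ∀ i, Irrational (β i))
    (x : UnitAddTorus (Fin m)) :
    torusCoding hβ hirr (x + torusPoint β) = productShift _ (torusCoding hβ hirr x) :=
  funext fun i => Subtype.ext (circleCoding_add (β i) (x i))

/-- The point of the torus of which a point of the product system is a coding. -/
def torusPhase (β : Fin m → ℝ) (x : ProductSpace fun i => rotationCoding (β i)) :
    UnitAddTorus (Fin m) :=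
  fun i => ((phase (β i) (x i) : ℝ) : UnitAddCircle)

theorem measurable_torusPhase (β : Fin m → ℝ) : Measurable (torusPhase β) :=
  measurable_pi_iff.2 fun i => AddCircle.measurable_mk'.comp
    ((measurable_phase (β i)).comp (measurable_subtype_coe.comp (measurable_pi_apply i)))

theorem torusPhase_productShift (hβ : ∀ i, β i ∈ Ioo (0 : ℝ) 1)
    (x : ProductSpace fun i => rotationCoding (β i)) :
    torusPhase β (productShift _ x) = torusPhase β x + torusPoint β := by
  funext i
  change ((phase (β i) (FullShift.shift (x i : FullShift)) : ℝ) : UnitAddCircle) =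
    ((phase (β i) (x i) : ℝ) : UnitAddCircle) + ((β i : ℝ) : UnitAddCircle)
  rw [phase_shift (hβ i) (x i).2, AddCircle.coe_sub, AddCircle.coe_add, sub_eq_self]
  exact (AddCircle.coe_eq_zero_iff 1).2 ⟨(((x i : FullShift) 0 : Fin 2) : ℕ), by simp⟩

theorem torusCoding_torusPhase (hβ : ∀ i, β i ∈ Ioo (0 : ℝ) 1) (hirr : ∀ i, Irrational (β i))
    {x : ProductSpace fun i => rotationCoding (β i)}
    (hx : ∀ i, torusPhase β x i ∉ range fun n : ℤ => ((n * β i : ℝ) : UnitAddCircle)) :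
    torusCoding hβ hirr (torusPhase β x) = x := by
  refine funext fun i => Subtype.ext ?_
  change circleCoding (β i) ((phase (β i) (x i) : ℝ) : UnitAddCircle) = _
  rw [circleCoding_coe, pointCoding_phase (hβ i) (x i).2 (hx i)]

theorem measurable_productShift (β : Fin m → ℝ) :
    Measurable (productShift fun i => rotationCoding (β i)) :=
  measurable_pi_iff.2 fun i =>
    (FullShift.shift.continuous.measurable.comp
      (measurable_subtype_coe.comp (measurable_pi_apply i))).subtype_mk

theorem volume_torus_eval_mem_eq_zero {s : Set UnitAddCircle} (hs : s.Countable) (i : Fin m) :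
    (volume : Measure (UnitAddTorus (Fin m))) {x | x i ∈ s} = 0 := by
  have h : MeasurePreserving (Function.eval i : UnitAddTorus (Fin m) → UnitAddCircle) :=
    measurePreserving_eval _ i
  exact (h.measure_preimage hs.measurableSet.nullMeasurableSet).trans (hs.measure_zero _)

theorem measurePreserving_add_torusPoint (β : Fin m → ℝ) :
    MeasurePreserving (· + torusPoint β) (volume : Measure (UnitAddTorus (Fin m))) volume :=
  measurePreserving_add_right _ _

/-- The phase pushes an invariant `ν` to an invariant measure of the torus rotation, hence to Haar
measure. Therefore `ν`-almost every phase avoids the countable orbit of `0` in each coordinate, the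
coding inverts the phase almost everywhere, and `ν` is the image of Haar measure under the coding.
-/
theorem isUniquelyErgodic_productShift (hβ : ∀ i, β i ∈ Ioo (0 : ℝ) 1)
    (hlin : LinearIndependent ℚ (Fin.cons 1 β : Fin (m + 1) → ℝ))
    (hirr : ∀ i, Irrational (β i)) :
    IsUniquelyErgodic (productShift fun i => rotationCoding (β i))
      (volume.map (torusCoding hβ hirr)) := by
  have hΦ := measurable_torusCoding hβ hirr
  have hπ := measurable_torusPhase β
  have hf := measurable_productShift β
  have hR := measurePreserving_add_torusPoint β
  refine ⟨Measure.isProbabilityMeasure_map hΦ.aemeasurable, ⟨hf, ?_⟩, fun ν hν hinv => ?_⟩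
  · rw [Measure.map_map hf hΦ]
    nth_rw 2 [← hR.map_eq]
    rw [Measure.map_map hΦ hR.measurable]
    exact congrArg (Measure.map · _) (funext fun x => (torusCoding_add hβ hirr x).symm)
  · have hprob : IsProbabilityMeasure (ν.map (torusPhase β)) :=
      Measure.isProbabilityMeasure_map hπ.aemeasurable
    have hinv' : MeasurePreserving (· + torusPoint β) (ν.map (torusPhase β))
        (ν.map (torusPhase β)) := by
      refine ⟨hR.measurable, ?_⟩
      rw [Measure.map_map hR.measurable hπ]
      nth_rw 2 [← hinv.map_eq]
      rw [Measure.map_map hπ hinv.measurable]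
      exact congrArg (Measure.map · _) (funext fun x => (torusPhase_productShift hβ x).symm)
    have hvol := eq_of_measurePreserving_add_torusPoint hlin hinv' hR
    rw [← hvol, Measure.map_map hΦ hπ]
    have hae : torusCoding hβ hirr ∘ torusPhase β =ᵐ[ν] id := by
      have hbad : ∀ᵐ y ∂(ν.map (torusPhase β)),
          ∀ i, y i ∉ range fun n : ℤ => ((n * β i : ℝ) : UnitAddCircle) := by
        rw [hvol, ae_all_iff]
        intro i
        rw [ae_iff]
        simpa only [not_not] using volume_torus_eval_mem_eq_zero (countable_range _) i
      filter_upwards [ae_of_ae_map hπ.aemeasurable hbad] with x hx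
      exact torusCoding_torusPhase hβ hirr hx
    rw [Measure.map_congr hae, Measure.map_id]

end Product

/-! ### Hamming distances -/

section Hamming

variable {X : Type*} {k : ℕ}

/-- The case `n = 0` is excluded because `0 / 0 = 0` makes the left side `1` and the right side `0`.
-/
theorem hammingDistance_eq_sum (f : X → X) (P : X → Fin k) {n : ℕ} (hn : 1 ≤ n) (x y : X) :
    hammingDistance f P n x y =
      (∑ s ∈ Finset.range n, if P (f^[s] x) = P (f^[s] y) then (0 : ℝ) else 1) / n := by
  have h := Finset.card_filter_add_card_filter_not (s := Finset.range n)
    (fun s => P (f^[s] x) = P (f^[s] y))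
  rw [Finset.card_range] at h
  have hn0 : (n : ℝ) ≠ 0 := by positivity
  have h' : (((Finset.range n).filter fun s => P (f^[s] x) = P (f^[s] y)).card : ℝ) +
      ((Finset.range n).filter fun s => ¬ P (f^[s] x) = P (f^[s] y)).card = n := by
    exact_mod_cast h
  rw [hammingDistance, Finset.sum_ite, Finset.sum_const_zero, zero_add, Finset.sum_const,
    nsmul_eq_mul, mul_one, eq_div_iff hn0, sub_mul, div_mul_cancel₀ _ hn0]
  linarith

theorem hammingDistance_comm (f : X → X) (P : X → Fin k) (n : ℕ) (x y : X) :
    hammingDistance f P n x y = hammingDistance f P n y x := by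
  simp only [hammingDistance, eq_comm]

theorem hammingDistance_self (f : X → X) (P : X → Fin k) {n : ℕ} (hn : 1 ≤ n) (x : X) :
    hammingDistance f P n x x = 0 := by
  simp [hammingDistance_eq_sum f P hn]

theorem hammingDistance_triangle (f : X → X) (P : X → Fin k) {n : ℕ} (hn : 1 ≤ n) (x y z : X) :
    hammingDistance f P n x z ≤ hammingDistance f P n x y + hammingDistance f P n y z := by
  simp only [hammingDistance_eq_sum f P hn]
  rw [← add_div, ← Finset.sum_add_distrib]
  gcongr with s
  split_ifs <;> grind

theorem measurable_hammingDistance [MeasurableSpace X] {Y : Type*} [MeasurableSpace Y] {f : X → X}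
    (hf : Measurable f) {P : X → Fin k} (hP : Measurable P) {n : ℕ} (hn : 1 ≤ n) {g g' : Y → X}
    (hg : Measurable g) (hg' : Measurable g') :
    Measurable fun y => hammingDistance f P n (g y) (g' y) := by
  simp only [hammingDistance_eq_sum f P hn]
  refine Measurable.div_const (Finset.measurable_sum _ fun s _ => ?_) _
  refine Measurable.ite ?_ measurable_const measurable_const
  exact measurableSet_eq_fun ((hP.comp (hf.iterate s)).comp hg) ((hP.comp (hf.iterate s)).comp hg')

theorem measurableSet_hammingBall [MeasurableSpace X] {f : X → X} (hf : Measurable f)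
    {P : X → Fin k} (hP : Measurable P) {n : ℕ} (hn : 1 ≤ n) (x : X) (ε : ℝ) :
    MeasurableSet (hammingBall f P n x ε) :=
  measurableSet_lt (measurable_hammingDistance hf hP hn measurable_const measurable_id)
    measurable_const

/-- A factor map transports Hamming covers. -/
theorem hammingCoverNumber_map_le {Y : Type*} [MeasurableSpace X] [MeasurableSpace Y]
    {μ : Measure Y} [IsFiniteMeasure μ] {g : Y → Y} {f : X → X} (hf : Measurable f) {Φ : Y → X}
    (hΦ : Measurable Φ) (hsemi : Function.Semiconj Φ g f) {P : X → Fin k} (hP : Measurable P)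
    (ε : ℝ) {n : ℕ} (hn : 1 ≤ n) :
    hammingCoverNumber (μ.map Φ) f P ε n ≤ hammingCoverNumber μ g (P ∘ Φ) ε n := by
  classical
  have hd : ∀ x y, hammingDistance g (P ∘ Φ) n x y = hammingDistance f P n (Φ x) (Φ y) := by
    intro x y
    simp only [hammingDistance, Function.comp_apply, (hsemi.iterate_right _).eq]
  refine le_iInf₂ fun F hF => iInf₂_le_of_le (F.image Φ) (hF.trans_le ?_)
    (Nat.cast_le.2 Finset.card_image_le)
  rw [measureReal_def, measureReal_def, Measure.map_apply hΦ
    (Finset.measurableSet_biUnion _ fun x _ => measurableSet_hammingBall hf hP hn x ε)]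
  refine ENNReal.toReal_mono (measure_ne_top _ _) (measure_mono ?_)
  refine iUnion₂_subset fun x hx y hy => ?_
  refine mem_iUnion₂.2 ⟨Φ x, Finset.mem_image_of_mem _ hx, ?_⟩
  change hammingDistance f P n (Φ x) (Φ y) < ε
  rw [← hd]
  exact hy

/-- If the balls of radius `ε` around the points of `A` have measure at least `c`, then `A` is
covered by at most `1 / c` balls of radius `2ε`. -/
theorem exists_finset_cover_of_le_measure [MeasurableSpace X] {μ : Measure X}
    [IsProbabilityMeasure μ] {d : X → X → ℝ} (hsymm : ∀ x y, d x y = d y x)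
    (hself : ∀ x, d x x = 0) (htri : ∀ x y z, d x z ≤ d x y + d y z) {ε : ℝ} (hε : 0 < ε)
    (hmeas : ∀ x, MeasurableSet {y | d x y < ε}) {A : Set X} {c : ℝ≥0∞} {C : ℕ}
    (hC : ∀ N : ℕ, N * c ≤ 1 → N ≤ C) (hA : ∀ x ∈ A, c ≤ μ {y | d x y < ε}) :
    ∃ F : Finset X, F.card ≤ C ∧ A ⊆ ⋃ x ∈ F, {y | d x y < 2 * ε} := by
  classical
  -- Sizes of `2ε`-separated subsets of `A`. Their `ε`-balls are disjoint, which bounds the size by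
  -- `C`; a separated set of maximal size has `2ε`-balls covering `A`.
  let sep : ℕ → Prop := fun N => ∃ F : Finset X, F.card = N ∧ (F : Set X) ⊆ A ∧
    (F : Set X).Pairwise fun x y => 2 * ε ≤ d x y
  have hbound : ∀ N, sep N → N ≤ C := by
    rintro N ⟨F, rfl, hFA, hF⟩
    refine hC _ ?_
    have hdisj : (F : Set X).PairwiseDisjoint fun x => {y | d x y < ε} := by
      intro x hx y hy hxy
      refine Set.disjoint_left.2 fun z (hz : d x z < ε) (hz' : d y z < ε) => ?_
      have h1 := hF hx hy hxy
      have h2 := htri x z y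
      rw [hsymm z y] at h2
      linarith
    calc (F.card : ℝ≥0∞) * c = ∑ x ∈ F, c := by rw [Finset.sum_const, nsmul_eq_mul]
      _ ≤ ∑ x ∈ F, μ {y | d x y < ε} := Finset.sum_le_sum fun x hx => hA x (hFA hx)
      _ = μ (⋃ x ∈ F, {y | d x y < ε}) :=
        (measure_biUnion_finset hdisj fun x _ => hmeas x).symm
      _ ≤ 1 := prob_le_one
  have h0 : sep 0 := ⟨∅, by simp⟩
  obtain ⟨F, hcard, hFA, hF⟩ := Nat.findGreatest_spec (P := sep) (Nat.zero_le C) h0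
  refine ⟨F, hbound _ ⟨F, rfl, hFA, hF⟩, fun y hy => ?_⟩
  by_contra hcov
  simp only [mem_iUnion, mem_ofPred_eq, not_exists, not_lt] at hcov
  have hyF : y ∉ F := fun h => by
    have := hcov y h
    rw [hself] at this
    linarith
  have hsep : sep (F.card + 1) := by
    refine ⟨insert y F, Finset.card_insert_of_notMem hyF, ?_, ?_⟩
    · rw [Finset.coe_insert]
      exact insert_subset hy hFA
    · rw [Finset.coe_insert]
      refine hF.insert fun x hx _ => ⟨?_, hcov x hx⟩
      rw [hsymm]
      exact hcov x hx
  have := Nat.le_findGreatest (hbound _ hsep) hsep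
  omega

end Hamming

/-! ### Hamming covers for rotations of compact groups -/

section Group

variable {G : Type*} [AddCommGroup G] [TopologicalSpace G] [IsTopologicalAddGroup G]
  [MeasurableSpace G] [BorelSpace G] {μ : Measure G} [μ.IsAddLeftInvariant] {k : ℕ}

/-- Rotation commutes with translation by `t`, so the Hamming distance is the orbit average of the
indicator of `{x | P (x + t) ≠ P x}`. Invariance gives every term the same integral, so the result
does not depend on `n`. -/
theorem lintegral_hammingDistance_translate [MeasurableAdd₂ G] (a : G) {P : G → Fin k}
    (hP : Measurable P) {n : ℕ} (hn : 1 ≤ n) (t : G) :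
    ∫⁻ x, ENNReal.ofReal (hammingDistance (· + a) P n x (x + t)) ∂μ =
      μ {x | P (x + t) ≠ P x} := by
  have hD : MeasurableSet {x | P (x + t) ≠ P x} :=
    (measurableSet_eq_fun (hP.comp (measurable_add_const t)) hP).compl
  have hiter : ∀ (s : ℕ) (x : G), (· + a)^[s] x = x + s • a := fun s x => by
    rw [add_right_iterate]
  have e : ∀ x, ENNReal.ofReal (hammingDistance (· + a) P n x (x + t)) =
      (∑ s ∈ Finset.range n, {x | P (x + t) ≠ P x}.indicator 1 (x + s • a)) / n := by
    intro x
    rw [hammingDistance_eq_sum _ _ hn, ENNReal.ofReal_div_of_pos (by positivity),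
      ENNReal.ofReal_sum_of_nonneg (fun s _ => by split_ifs <;> norm_num), ENNReal.ofReal_natCast]
    congr 1
    refine Finset.sum_congr rfl fun s _ => ?_
    rw [hiter, hiter, add_right_comm x t]
    by_cases h : P (x + s • a + t) = P (x + s • a)
    · rw [if_pos h.symm, indicator_of_notMem (not_not.2 h : ¬ P (x + s • a + t) ≠ P (x + s • a)), ENNReal.ofReal_zero]
    · rw [if_neg (Ne.symm h), indicator_of_mem (show _ ∈ {x | P (x + t) ≠ P x} from h),
        ENNReal.ofReal_one, Pi.one_apply]
  have hind : ∀ s : ℕ, Measurable fun x =>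
      ({x | P (x + t) ≠ P x}.indicator 1 (x + s • a) : ℝ≥0∞) := fun s =>
    (measurable_one.indicator hD).comp (measurable_add_const _)
  simp only [e, div_eq_mul_inv]
  rw [lintegral_mul_const _ (Finset.measurable_sum _ fun s _ => hind s),
    lintegral_finsetSum _ fun s _ => hind s]
  have hs : ∀ s : ℕ, ∫⁻ x, {x | P (x + t) ≠ P x}.indicator 1 (x + s • a) ∂μ =
      μ {x | P (x + t) ≠ P x} := fun s => by
    rw [lintegral_add_right_eq_self (fun x => {x | P (x + t) ≠ P x}.indicator 1 x),
      lintegral_indicator_one hD]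
  rw [Finset.sum_congr rfl fun s _ => hs s, Finset.sum_const, Finset.card_range, nsmul_eq_mul,
    mul_comm, ← mul_assoc, ENNReal.inv_mul_cancel (by simp; omega) (by simp), one_mul]

variable [IsProbabilityMeasure μ]

theorem tendsto_measure_translate_ne [R1Space G] [μ.InnerRegularCompactLTTop] {P : G → Fin k}
    (hP : Measurable P) : Tendsto (fun t => μ {x | P (x + t) ≠ P x}) (𝓝 0) (𝓝 0) := by
  let τ : G → C(G, G) := fun t => ⟨fun x => x + t, by fun_prop⟩
  have hτ : Continuous τ := ContinuousMap.continuous_of_continuous_uncurry _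
    (show Continuous fun p : G × G => p.2 + p.1 by fun_prop)
  have hmp : ∀ t, MeasurePreserving (τ t) μ μ := fun t => measurePreserving_add_right μ t
  have hc : ∀ c : Fin k, Tendsto
      (fun t => μ (symmDiff (τ t ⁻¹' (P ⁻¹' {c})) (τ 0 ⁻¹' (P ⁻¹' {c})))) (𝓝 0) (𝓝 0) := fun c =>
    tendsto_measure_symmDiff_preimage_nhds_zero (hτ.tendsto 0) (.of_forall hmp) (hmp 0)
      (hP (measurableSet_singleton c)).nullMeasurableSet (measure_ne_top _ _)
  have hsum := tendsto_finsetSum Finset.univ fun c _ => hc c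
  rw [Finset.sum_const_zero] at hsum
  refine tendsto_of_tendsto_of_tendsto_of_le_of_le tendsto_const_nhds hsum
    (fun _ => zero_le) fun t => ?_
  refine (measure_mono ?_).trans (measure_iUnion_fintype_le μ _)
  intro x hx
  -- A point whose label changes leaves its own atom `P ⁻¹' {P x}`, so it lies in that atom's
  -- symmetric difference.
  refine mem_iUnion.2 ⟨P x, Or.inr ⟨?_, hx⟩⟩
  simp [τ]

/-- The Hamming cover numbers of a rotation of a compact group are bounded. -/
theorem exists_forall_hammingCoverNumber_le [R1Space G] [MeasurableAdd₂ G]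
    [μ.InnerRegularCompactLTTop] [μ.IsOpenPosMeasure] (a : G) {P : G → Fin k} (hP : Measurable P)
    {ε : ℝ} (hε : 0 < ε) :
    ∃ C : ℕ, ∀ n : ℕ, 1 ≤ n → hammingCoverNumber μ (· + a) P (2 * ε) n ≤ C := by
  -- Markov's inequality is used twice: at level `ε` it turns `ε * ε / 2` into `ε / 2`, and at level
  -- `w / 2` it turns `ε / 2 * w` into `ε`. The neighbourhood `W`, and hence `w` and `C`, are fixed
  -- before `n`.
  set δ : ℝ≥0∞ := ENNReal.ofReal (ε * ε / 2) with hδ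
  have hδ0 : 0 < δ := ENNReal.ofReal_pos.2 (by positivity)
  obtain ⟨W, hW, hWo, h0W⟩ := eventually_nhds_iff.1
    ((tendsto_measure_translate_ne (μ := μ) hP).eventually (gt_mem_nhds hδ0))
  set w := μ W with hw
  have hw0 : w ≠ 0 := (hWo.measure_pos μ ⟨0, h0W⟩).ne'
  have hwt : w ≠ ∞ := measure_ne_top _ _
  have hw2 : w / 2 ≠ 0 := by simp [hw0]
  obtain ⟨C, hC⟩ := ENNReal.exists_nat_gt (r := 1 / (w / 2)) (ENNReal.div_ne_top (by simp) hw2)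
  have hC' : ∀ N : ℕ, N * (w / 2) ≤ 1 → N ≤ C := by
    intro N hN
    have := (ENNReal.le_div_iff_mul_le (Or.inl hw2)
      (Or.inl (ENNReal.div_ne_top hwt (by simp)))).2 hN
    exact_mod_cast this.trans hC.le
  refine ⟨C, fun n hn => ?_⟩
  have hR : Measurable fun x : G => x + a := measurable_add_const a
  set d := hammingDistance (· + a) P n with hd
  set E : Set (G × G) := {p | p.2 ∈ W ∧ ε ≤ d p.1 (p.1 + p.2)} with hE
  have hdm : Measurable fun p : G × G => d p.1 (p.1 + p.2) :=
    measurable_hammingDistance hR hP hn measurable_fst measurable_add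
  have hEm : MeasurableSet E :=
    (measurable_snd hWo.measurableSet).inter (measurableSet_le measurable_const hdm)
  have hslice : ∀ t ∈ W, μ {y | ε ≤ d y (y + t)} ≤ δ / ENNReal.ofReal ε := by
    intro t ht
    have hdt : Measurable fun y => ENNReal.ofReal (d y (y + t)) :=
      (measurable_hammingDistance hR hP hn measurable_id (measurable_add_const t)).ennreal_ofReal
    refine (measure_mono fun y (hy : ε ≤ _) => ENNReal.ofReal_le_ofReal hy).trans
      ((meas_ge_le_lintegral_div hdt.aemeasurable (by simpa using hε) (by simp)).trans ?_)
    rw [hd, lintegral_hammingDistance_translate a hP hn]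
    exact ENNReal.div_le_div_right (hW t ht).le _
  -- By Fubini, the bound for each `t ∈ W` over all `y` becomes a bound for the average `y` over
  -- `t`.
  have hprod : ∫⁻ y, μ (Prod.mk y ⁻¹' E) ∂μ ≤ δ / ENNReal.ofReal ε * w := by
    rw [← Measure.prod_apply hEm, Measure.prod_apply_symm hEm]
    have hle : ∀ t, μ ((fun y => (y, t)) ⁻¹' E) ≤ W.indicator (fun _ => δ / ENNReal.ofReal ε) t := by
      intro t
      by_cases ht : t ∈ W
      · rw [indicator_of_mem ht]
        exact (measure_mono fun y hy => hy.2).trans (hslice t ht)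
      · rw [indicator_of_notMem ht]
        refine le_of_eq (measure_mono_null (fun y hy => ht hy.1) measure_empty)
    refine (lintegral_mono hle).trans (le_of_eq ?_)
    rw [lintegral_indicator_const hWo.measurableSet]
  set bad : Set G := {y | w / 2 ≤ μ (Prod.mk y ⁻¹' E)} with hbad
  have hbadm : MeasurableSet bad :=
    measurableSet_le measurable_const (measurable_measure_prodMk_left hEm)
  have hbadμ : μ bad ≤ ENNReal.ofReal ε := by
    refine (meas_ge_le_lintegral_div (measurable_measure_prodMk_left hEm).aemeasurable hw2
      (ENNReal.div_ne_top hwt (by simp))).trans ?_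
    refine ENNReal.div_le_of_le_mul (hprod.trans (le_of_eq ?_))
    have hδε : δ / ENNReal.ofReal ε = ENNReal.ofReal (ε / 2) := by
      rw [hδ, ← ENNReal.ofReal_div_of_pos hε]
      congr 1
      field_simp
    rw [hδε, ENNReal.ofReal_div_of_pos two_pos, ENNReal.ofReal_ofNat, div_eq_mul_inv,
      div_eq_mul_inv, mul_assoc, mul_comm w]
  -- For good `y`, less than half of `W` displaces `y` by `ε` or more; the rest, translated by `y`,
  -- lies in the Hamming ball.
  have hgood : ∀ y ∈ badᶜ, w / 2 ≤ μ {x | d y x < ε} := by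
    intro y hy
    have hy' : μ (Prod.mk y ⁻¹' E) < w / 2 := not_le.1 hy
    have hsub : W ⊆ (Prod.mk y ⁻¹' E) ∪ (fun t => y + t) ⁻¹' {x | d y x < ε} := by
      intro t ht
      rcases le_or_gt ε (d y (y + t)) with h | h
      · exact Or.inl ⟨ht, h⟩
      · exact Or.inr h
    have hle := (measure_mono hsub).trans (measure_union_le (μ := μ) _ _)
    rw [measure_preimage_add] at hle
    by_contra! hlt
    have := hle.trans_lt (ENNReal.add_lt_add hy' hlt)
    rw [ENNReal.add_halves] at this
    exact lt_irrefl _ this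
  obtain ⟨F, hFC, hF⟩ := exists_finset_cover_of_le_measure (μ := μ) (d := d)
    (hammingDistance_comm _ P n) (hammingDistance_self _ P hn)
    (hammingDistance_triangle _ P hn) hε (fun x => measurableSet_hammingBall hR hP hn x ε)
    hC' hgood
  refine iInf₂_le_of_le F ?_ (Nat.cast_le.2 hFC)
  have h1 : μ.real bad ≤ ε := ENNReal.toReal_le_of_le_ofReal hε.le hbadμ
  have h2 : μ.real badᶜ = 1 - μ.real bad := probReal_compl_eq_one_sub hbadm
  have h3 : μ.real badᶜ ≤ μ.real (⋃ x ∈ F, hammingBall (· + a) P n x (2 * ε)) :=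
    measureReal_mono hF (measure_ne_top _ _)
  linarith

end Group

/-! ### Metric slow entropy of products of Sturmian systems -/

/-- A partition of the product space pulls back through the coding to one of the torus, where the
cover numbers are bounded in `n`. -/
theorem metricSlowEntropy_productShift {m : ℕ} {β : Fin m → ℝ} (hβ : ∀ i, β i ∈ Ioo (0 : ℝ) 1)
    (hirr : ∀ i, Irrational (β i)) :
    metricSlowEntropy polyScale (volume.map (torusCoding hβ hirr))
      (productShift fun i => rotationCoding (β i)) = 0 := by
  refine le_antisymm (iSup_le fun k => iSup₂_le fun P hP => ?_) zero_le
  refine limsup_le_of_le (h := ?_)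
  filter_upwards [self_mem_nhdsWithin] with ε (hε : 0 < ε)
  have hΦ := measurable_torusCoding hβ hirr
  obtain ⟨C, hC⟩ := exists_forall_hammingCoverNumber_le
    (μ := (volume : Measure (UnitAddTorus (Fin m)))) (torusPoint β) (hP.comp hΦ) (half_pos hε)
  rw [mul_div_cancel₀ ε two_ne_zero] at hC
  refine (growthExponent_le_of_le_mul_pow 0 C fun n hn => ?_).trans (by simp)
  rw [pow_zero, mul_one]
  exact (hammingCoverNumber_map_le (measurable_productShift β) hΦ
    (torusCoding_add hβ hirr) hP ε hn).trans (hC n hn)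

/-! ### Rationally independent numbers -/

/-- Algebraic numbers are countable; the interval is not. -/
theorem exists_transcendental_mem_Ioo : ∃ x ∈ Ioo (0 : ℝ) 1, Transcendental ℚ x := by
  by_contra! h
  have hsub : Ioo (0 : ℝ) 1 ⊆ {x | IsAlgebraic ℚ x} := fun x hx => not_not.1 (h x hx)
  have hc := (Algebraic.countable ℚ ℝ).mono hsub
  exact (Cardinal.Real.Ioo_countable_iff.1 hc).not_gt zero_lt_one

theorem exists_linearIndependent_cons_one (m : ℕ) :
    ∃ β : Fin m → ℝ, (∀ i, β i ∈ Ioo (0 : ℝ) 1) ∧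
      LinearIndependent ℚ (Fin.cons 1 β : Fin (m + 1) → ℝ) := by
  obtain ⟨x, ⟨h0, h1⟩, hx⟩ := exists_transcendental_mem_Ioo
  -- With `1 = x ^ 0`, these powers are images of distinct monomials under evaluation at `x`, which
  -- is injective by transcendence.
  refine ⟨fun i => x ^ ((i : ℕ) + 1), fun i => ⟨by positivity, pow_lt_one₀ h0.le h1 (by simp)⟩, ?_⟩
  have hker : LinearMap.ker (Polynomial.aeval x : Polynomial ℚ →ₐ[ℚ] ℝ).toLinearMap = ⊥ :=
    LinearMap.ker_eq_bot.2 (transcendental_iff_injective.1 hx)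
  have hli := ((Polynomial.basisMonomials ℚ).linearIndependent.map' _ hker).comp
    (Fin.val : Fin (m + 1) → ℕ) Fin.val_injective
  have e : (Fin.cons 1 fun i : Fin m => x ^ ((i : ℕ) + 1) : Fin (m + 1) → ℝ) =
      (Polynomial.aeval x : Polynomial ℚ →ₐ[ℚ] ℝ).toLinearMap ∘
        Polynomial.basisMonomials ℚ ∘ Fin.val := by
    funext i
    refine Fin.cases ?_ (fun i => ?_) i <;> simp
  rw [e]
  exact hli

end SlowEntropy

end

open SlowEntropy in
theorem mainTheorem9 (m : ℕ) :
    ∃ β : Fin m → ℝ,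
      (∀ i, β i ∈ Set.Ioo (0 : ℝ) 1) ∧
      LinearIndependent ℚ (Fin.cons 1 β : Fin (m + 1) → ℝ) ∧
      (∀ i, IsSturmian (rotationCoding (β i))) ∧
      CompactSpace (ProductSpace fun i => rotationCoding (β i)) ∧
      ∃ μ : MeasureTheory.Measure (ProductSpace fun i => rotationCoding (β i)),
        IsUniquelyErgodic (productShift fun i => rotationCoding (β i)) μ ∧
        metricSlowEntropy polyScale μ (productShift fun i => rotationCoding (β i)) = 0 ∧
        topSlowEntropy polyScale (productShift fun i => rotationCoding (β i)) = m := by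
  obtain ⟨β, hβ, hlin⟩ := exists_linearIndependent_cons_one m
  have hirr := irrational_of_linearIndependent hlin
  have hst : ∀ i, IsSturmian (rotationCoding (β i)) := fun i =>
    isSturmian_rotationCoding (hβ i) (hirr i)
  exact ⟨β, hβ, hlin, hst, inferInstance, _, isUniquelyErgodic_productShift hβ hlin hirr,
    metricSlowEntropy_productShift hβ hirr, topSlowEntropy_productShift hst⟩
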